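/- Fix an integer $s\ge 1$ and let $F_{2,2s}$ be the set of real binary forms $p(x,y)$ of degree $2s$ (homogeneous polynomials of degree $2s$, together with $0$). An honest representation of $p\in F_{2,2s}$ is an identity $$p(x,y)=\sum_{j=1}^r\lambda_j(\alpha_jx+\beta_jy)^{2s},\qquad r\ge 0,\quad 0\ne\lambda_j\in\mathbb R,\quad \alpha_j,\beta_j\in\mathbb R,$$ in which the linear forms $\alpha_jx+\beta_jy$ are nonzero and pairwise non-proportional (the empty sum represents $0$). Its badge is $(a,b)$, where $a$ is the number of positive and $b$ the number of negative $\lambda_j$. Let $\mathcal B(p)$ be the set of badges of all honest representations of $p$, ordered by $(a,b)\preceq(c,d)$ if and only if $a\le c$ and $b\le d$, and let $\mathcal S(p)$ be the set of minimal elements of $\mathcal B(p)$, called the signatures of $p$. Write $[0,s]^2=\{(i,j)\in\mathbb Z^2: 0\le i,j\le s\}$. 1. If $p\in F_{2,2s}$, then $\mathcal S(p)\subseteq\{(s+1,0),(0,s+1)\}\cup[0,s]^2$. 2. If $p\in F_{2,2s}$ is a product of $2s$ real linear forms and is not equal to $\ell^{2s}$ or $-\ell^{2s}$ for any real linear form $\ell$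 (including $\ell=0$, so that $p\neq 0$), then $\mathcal S(p)=\{(s,s)\}$. 3. For every $(u,v)\in\{(s+1,0),(0,s+1)\}\cup[0,s]^2$ there exists $p\in F_{2,2s}$ with $\mathcal S(p)=\{(u,v)\}$. -/

import Mathlib

open MvPolynomial

/-- The real linear form `a₁ x₁ + ⋯ + aₙ xₙ` with coefficient vector `a`. -/
noncomputable def linForm {n : ℕ} (a : Fin n → ℝ) : MvPolynomial (Fin n) ℝ :=
  ∑ i, C (a i) * X i

/-- `F n d`: the real forms of degree `d` in `n` variables (the zero form included). -/
noncomputable abbrev F (n d : ℕ) : Submodule ℝ (MvPolynomial (Fin n) ℝ) :=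
  homogeneousSubmodule (Fin n) ℝ d

/-- `p = ∑ⱼ lam j * (L j) ^ (2 s)` is an honest representation of `p` as a linear combination of
`r` powers of real linear forms: the coefficients and the linear forms are nonzero, and no two of
the linear forms are proportional. The empty representation (`r = 0`) of `0` is allowed. -/
structure IsHonestRep {n : ℕ} (s : ℕ) (p : MvPolynomial (Fin n) ℝ) (r : ℕ)
    (lam : Fin r → ℝ) (L : Fin r → Fin n → ℝ) : Prop where
  coeff_ne_zero : ∀ j, lam j ≠ 0
  form_ne_zero : ∀ j, L j ≠ 0
  distinct : ∀ j k, j ≠ k → LinearIndependent ℝ ![L j, L k]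
  eq_sum : p = ∑ j, C (lam j) * linForm (L j) ^ (2 * s)

/-- The badge `(a, b)` of a representation with coefficients `lam`: the numbers of positive and
of negative coefficients. -/
noncomputable def badge {r : ℕ} (lam : Fin r → ℝ) : ℕ × ℕ :=
  (Nat.card {j // 0 < lam j}, Nat.card {j // lam j < 0})

/-- The set `B(p)` of badges of honest representations of a form `p` of degree `2 s`. -/
def badges {n : ℕ} (s : ℕ) (p : MvPolynomial (Fin n) ℝ) : Set (ℕ × ℕ) :=
  {ab | ∃ (r : ℕ) (lam : Fin r → ℝ) (L : Fin r → Fin n → ℝ),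
    IsHonestRep s p r lam L ∧ badge lam = ab}

/-- The set `S(p)` of signatures of `p`: the minimal elements of `B(p)` for the componentwise
order. -/
def signatures {n : ℕ} (s : ℕ) (p : MvPolynomial (Fin n) ℝ) : Set (ℕ × ℕ) :=
  {ab | Minimal (fun cd => cd ∈ badges s p) ab}

/-- The set `{(s + 1, 0), (0, s + 1)} ∪ [0, s]²`. -/
def possibleSignatures (s : ℕ) : Set (ℕ × ℕ) :=
  {(s + 1, 0), (0, s + 1)} ∪ Set.Icc 0 s ×ˢ Set.Icc 0 s

/-! Honesty can be ignored: proportional forms merge or cancel without raising either count, so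
signatures are the minimal pairs `(a, b)` for which `p` is a sum of `a` powers minus a sum of `b`
powers of arbitrary linear forms (`mem_signatures_iff`). Lower bounds on the counts come from the
apolar pairing: for `f` of degree at most `s`, pairing `f ^ 2` with such an expression gives `∑
f(Pᵢ)² - ∑ f(Nⱼ)²`, and a well-chosen `f` makes the signs incompatible.

Part 1 is Gauss quadrature. With a linear form `l` placed at infinity, `s + 1` pairwise independent
powers become `s` powers plus `ν l²ˢ` with `ν ≥ 0` (`exists_sum_linForm_pow_eq`). Taking `l` to be
any further form of the representation, positive or negative, absorbs `ν l²ˢ` into its term and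
contradicts minimality (`MinimalRep.eq_of_lt_fst`).

Part 2 uses Rolle: directional derivatives of a product of real linear forms are again such
products, so every derivative of order `2s - 2` is a quadratic form with a nontrivial real zero.
With fewer than `s` positive terms, all of them can be killed by differentiating in pairs; two
negative terms would then leave a definite quadratic. The remaining small cases are excluded
separately (`IsHyperbolic.le_fst`). The same for `-p`, with part 1, forces `(s, s)`.

Part 3: a sum of `s + 1` powers at distinct nodes, and its negative, give the two exceptional pairs.
For the square, the functional `g ↦ Im g(i)` is a quadrature with `s` positive and `s` negative
nodes. Keeping `u` of the positive ones and `v` of the negative ones, the latter slightly weakened,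
gives a form whose only signature is `(u, v)` (`exists_signatures_eq_of_le`). -/

theorem linForm_smul {n : ℕ} (c : ℝ) (L : Fin n → ℝ) : linForm (c • L) = C c * linForm L := by
  simp [linForm, Finset.mul_sum, mul_assoc]

theorem linForm_add {n : ℕ} (L M : Fin n → ℝ) : linForm (L + M) = linForm L + linForm M := by
  simp [linForm, Finset.sum_add_distrib, add_mul]

theorem linForm_zero {n : ℕ} : linForm (0 : Fin n → ℝ) = 0 := by simp [linForm]

/-! ### Relaxed representations and minimality -/

/-- `p` is a sum of `a` powers of linear forms minus a sum of `b` such powers; the linear forms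
may vanish or coincide. -/
def HasRep (s : ℕ) (p : MvPolynomial (Fin 2) ℝ) (a b : ℕ) : Prop :=
  ∃ (P : Fin a → Fin 2 → ℝ) (N : Fin b → Fin 2 → ℝ),
    p = ∑ i, linForm (P i) ^ (2 * s) - ∑ j, linForm (N j) ^ (2 * s)

/-- The determinant of a pair of vectors in the plane. -/
def det2 (u v : Fin 2 → ℝ) : ℝ := u 0 * v 1 - u 1 * v 0

theorem det2_swap (u v : Fin 2 → ℝ) : det2 v u = -det2 u v := by simp only [det2]; ring

theorem exists_smul_of_det2_eq_zero {u v : Fin 2 → ℝ} (hu : u ≠ 0) (h : det2 u v = 0) :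
    ∃ c : ℝ, v = c • u := by
  have hsq : u 0 ^ 2 + u 1 ^ 2 ≠ 0 := by
    intro h0
    apply hu
    ext i
    fin_cases i <;> simp <;> nlinarith [sq_nonneg (u 0), sq_nonneg (u 1)]
  refine ⟨(u 0 * v 0 + u 1 * v 1) / (u 0 ^ 2 + u 1 ^ 2), ?_⟩
  simp only [det2] at h
  ext i
  fin_cases i
  · simp only [Fin.zero_eta, Pi.smul_apply, smul_eq_mul]
    field_simp
    linear_combination -u 1 * h
  · simp only [Fin.mk_one, Pi.smul_apply, smul_eq_mul]
    field_simp
    linear_combination u 0 * h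

theorem linearIndependent_of_det2_ne_zero {u v : Fin 2 → ℝ} (h : det2 u v ≠ 0) :
    LinearIndependent ℝ ![u, v] := by
  rw [LinearIndependent.pair_iff]
  intro x y hxy
  have h0 := congrFun hxy 0
  have h1 := congrFun hxy 1
  simp only [Pi.add_apply, Pi.smul_apply, smul_eq_mul, Pi.zero_apply] at h0 h1
  constructor
  · apply (mul_eq_zero.1 (_ : x * det2 u v = 0)).resolve_right h
    simp only [det2]; linear_combination v 1 * h0 - v 0 * h1
  · apply (mul_eq_zero.1 (_ : y * det2 u v = 0)).resolve_right h
    simp only [det2]; linear_combination u 0 * h1 - u 1 * h0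

theorem exists_root_smul {s : ℕ} (hs : 1 ≤ s) {c : ℝ} (hc : 0 ≤ c) (L : Fin 2 → ℝ) :
    ∃ d : ℝ, linForm (d • L) ^ (2 * s) = C c * linForm L ^ (2 * s) := by
  refine ⟨c ^ (((2 * s : ℕ) : ℝ)⁻¹), ?_⟩
  rw [linForm_smul, mul_pow, ← C_pow, Real.rpow_inv_natCast_pow hc (by omega)]

theorem linForm_pow_add_of_det2_eq_zero {s : ℕ} (hs : 1 ≤ s) {u v : Fin 2 → ℝ}
    (h : det2 u v = 0) :
    ∃ w, linForm u ^ (2 * s) + linForm v ^ (2 * s) = linForm w ^ (2 * s) := by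
  by_cases hu : u = 0
  · exact ⟨v, by rw [hu, linForm_zero, zero_pow (by omega), zero_add]⟩
  · obtain ⟨c, rfl⟩ := exists_smul_of_det2_eq_zero hu h
    have hc : 0 ≤ 1 + c ^ (2 * s) := by rw [pow_mul]; positivity
    obtain ⟨d, hd⟩ := exists_root_smul hs hc u
    refine ⟨d • u, ?_⟩
    rw [hd, linForm_smul, mul_pow, C_add, C_pow, C_1]
    ring

/-- The sign of `1 - c ^ (2 * s)` decides which side survives; either way a positive and a negative
term collapse to a single term. -/
theorem linForm_pow_sub_of_det2_eq_zero {s : ℕ} (hs : 1 ≤ s) {u v : Fin 2 → ℝ}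
    (h : det2 u v = 0) :
    (∃ w, linForm u ^ (2 * s) - linForm v ^ (2 * s) = linForm w ^ (2 * s)) ∨
    (∃ w, linForm u ^ (2 * s) - linForm v ^ (2 * s) = -linForm w ^ (2 * s)) := by
  by_cases hu : u = 0
  · exact Or.inr ⟨v, by rw [hu, linForm_zero, zero_pow (by omega), zero_sub]⟩
  · obtain ⟨c, rfl⟩ := exists_smul_of_det2_eq_zero hu h
    rcases le_total 0 (1 - c ^ (2 * s)) with hc | hc
    · obtain ⟨d, hd⟩ := exists_root_smul hs hc u
      refine Or.inl ⟨d • u, ?_⟩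
      rw [hd, linForm_smul, mul_pow, C_sub, C_pow, C_1]
      ring
    · obtain ⟨d, hd⟩ := exists_root_smul hs (neg_nonneg.2 hc) u
      refine Or.inr ⟨d • u, ?_⟩
      rw [hd, linForm_smul, mul_pow, C_neg, C_sub, C_pow, C_1]
      ring

theorem HasRep.neg {s : ℕ} {p : MvPolynomial (Fin 2) ℝ} {a b : ℕ} (h : HasRep s p a b) :
    HasRep s (-p) b a := by
  obtain ⟨P, N, rfl⟩ := h
  exact ⟨N, P, by ring⟩

theorem hasRep_of_finset {s : ℕ} {ι κ : Type*} (t : Finset ι) (u : Finset κ)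
    (P : ι → Fin 2 → ℝ) (N : κ → Fin 2 → ℝ) :
    HasRep s (∑ i ∈ t, linForm (P i) ^ (2 * s) - ∑ j ∈ u, linForm (N j) ^ (2 * s))
      t.card u.card := by
  refine ⟨fun i => P (t.equivFin.symm i), fun j => N (u.equivFin.symm j), ?_⟩
  rw [Equiv.sum_comp t.equivFin.symm fun i : t => linForm (P i) ^ (2 * s),
    Equiv.sum_comp u.equivFin.symm fun i : u => linForm (N i) ^ (2 * s),
    Finset.sum_coe_sort t fun i => linForm (P i) ^ (2 * s),
    Finset.sum_coe_sort u fun i => linForm (N i) ^ (2 * s)]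

theorem HasRep.of_sum_weights {s : ℕ} (hs : 1 ≤ s) {ι κ : Type*} (t : Finset ι) (u : Finset κ)
    (P : ι → Fin 2 → ℝ) (N : κ → Fin 2 → ℝ) (c : ι → ℝ) (d : κ → ℝ)
    (hc : ∀ i ∈ t, 0 ≤ c i) (hd : ∀ j ∈ u, 0 ≤ d j) :
    HasRep s (∑ i ∈ t, C (c i) * linForm (P i) ^ (2 * s) -
      ∑ j ∈ u, C (d j) * linForm (N j) ^ (2 * s)) t.card u.card := by
  have h1 : ∀ i, ∃ Q : Fin 2 → ℝ, i ∈ t → linForm Q ^ (2 * s) = C (c i) * linForm (P i) ^ (2 * s) := by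
    intro i
    by_cases hi : i ∈ t
    · obtain ⟨e, he⟩ := exists_root_smul hs (hc i hi) (P i)
      exact ⟨_, fun _ => he⟩
    · exact ⟨0, fun h => absurd h hi⟩
  have h2 : ∀ i, ∃ Q : Fin 2 → ℝ, i ∈ u → linForm Q ^ (2 * s) = C (d i) * linForm (N i) ^ (2 * s) := by
    intro i
    by_cases hi : i ∈ u
    · obtain ⟨e, he⟩ := exists_root_smul hs (hd i hi) (N i)
      exact ⟨_, fun _ => he⟩
    · exact ⟨0, fun h => absurd h hi⟩
  choose P' hP' using h1
  choose N' hN' using h2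
  rw [← Finset.sum_congr rfl hP', ← Finset.sum_congr rfl hN']
  exact hasRep_of_finset t u P' N'

/-- Minimal pairs `(a, b)` with `HasRep s p a b`. -/
abbrev MinimalRep (s : ℕ) (p : MvPolynomial (Fin 2) ℝ) (ab : ℕ × ℕ) : Prop :=
  Minimal (fun cd : ℕ × ℕ => HasRep s p cd.1 cd.2) ab

theorem MinimalRep.neg {s : ℕ} {p : MvPolynomial (Fin 2) ℝ} {a b : ℕ}
    (h : MinimalRep s p (a, b)) : MinimalRep s (-p) (b, a) := by
  refine ⟨h.1.neg, fun cd hcd hle => ?_⟩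
  have hcd' : HasRep s p cd.2 cd.1 := by simpa using HasRep.neg hcd
  have := h.2 (y := (cd.2, cd.1)) hcd' ⟨hle.2, hle.1⟩
  exact ⟨this.2, this.1⟩

theorem HasRep.exists_minimal {s : ℕ} {p : MvPolynomial (Fin 2) ℝ} {a b : ℕ}
    (h : HasRep s p a b) : ∃ ab : ℕ × ℕ, ab ≤ (a, b) ∧ MinimalRep s p ab := by
  obtain ⟨m, hm, hmin⟩ :=
    exists_minimal_le_of_wellFoundedLT (fun cd : ℕ × ℕ => HasRep s p cd.1 cd.2) (a, b) h
  exact ⟨m, hm, hmin⟩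

theorem MinimalRep.not_fst {s : ℕ} {p : MvPolynomial (Fin 2) ℝ} {a b a' : ℕ}
    (h : MinimalRep s p (a, b)) (ha : a' < a) : ¬ HasRep s p a' b := fun h' =>
  absurd (h.2 (y := (a', b)) h' ⟨ha.le, le_rfl⟩).1 (not_le.2 ha)

theorem MinimalRep.not_snd {s : ℕ} {p : MvPolynomial (Fin 2) ℝ} {a b b' : ℕ}
    (h : MinimalRep s p (a, b)) (hb : b' < b) : ¬ HasRep s p a b' := fun h' =>
  absurd (h.2 (y := (a, b')) h' ⟨le_rfl, hb.le⟩).2 (not_le.2 hb)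

theorem MinimalRep.left_ne_zero {s : ℕ} (hs : 1 ≤ s) {a b : ℕ} {P : Fin a → Fin 2 → ℝ}
    {N : Fin b → Fin 2 → ℝ}
    (h : MinimalRep s (∑ i, linForm (P i) ^ (2 * s) - ∑ j, linForm (N j) ^ (2 * s)) (a, b))
    (i : Fin a) : P i ≠ 0 := by
  intro hi
  have := hasRep_of_finset (s := s) (Finset.univ.erase i) Finset.univ P N
  rw [Finset.sum_erase _ (by rw [hi, linForm_zero, zero_pow (by omega)]),
    Finset.card_erase_of_mem (Finset.mem_univ i)] at this
  simp only [Finset.card_univ, Fintype.card_fin] at this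
  exact h.not_fst (by have := i.2; omega) this

theorem MinimalRep.left_det2_ne_zero {s : ℕ} (hs : 1 ≤ s) {a b : ℕ} {P : Fin a → Fin 2 → ℝ}
    {N : Fin b → Fin 2 → ℝ}
    (h : MinimalRep s (∑ i, linForm (P i) ^ (2 * s) - ∑ j, linForm (N j) ^ (2 * s)) (a, b))
    {i j : Fin a} (hij : i ≠ j) : det2 (P i) (P j) ≠ 0 := by
  intro hd
  obtain ⟨w, hw⟩ := linForm_pow_add_of_det2_eq_zero hs hd
  have := hasRep_of_finset (s := s) (Finset.univ.erase j) Finset.univ (Function.update P i w) N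
  rw [Finset.card_erase_of_mem (Finset.mem_univ j)] at this
  have hi : i ∈ Finset.univ.erase j := by simp [hij]
  have key : ∑ k ∈ Finset.univ.erase j, linForm (Function.update P i w k) ^ (2 * s) =
      ∑ k, linForm (P k) ^ (2 * s) := by
    rw [← Finset.add_sum_erase _ _ hi, ← Finset.add_sum_erase _ _ (Finset.mem_univ j),
      ← Finset.add_sum_erase _ (fun k => linForm (P k) ^ (2 * s)) hi, Function.update_self, ← hw,
      Finset.sum_congr rfl fun k hk => by rw [Function.update_of_ne (Finset.ne_of_mem_erase hk)]]
    ring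
  rw [key] at this
  simp only [Finset.card_univ, Fintype.card_fin] at this
  exact h.not_fst (by have := i.2; omega) this

theorem MinimalRep.det2_ne_zero {s : ℕ} (hs : 1 ≤ s) {a b : ℕ} {P : Fin a → Fin 2 → ℝ}
    {N : Fin b → Fin 2 → ℝ}
    (h : MinimalRep s (∑ i, linForm (P i) ^ (2 * s) - ∑ j, linForm (N j) ^ (2 * s)) (a, b))
    (i : Fin a) (j : Fin b) : det2 (P i) (N j) ≠ 0 := by
  intro hd
  have hP := Finset.add_sum_erase _ (fun k => linForm (P k) ^ (2 * s)) (Finset.mem_univ i)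
  have hN := Finset.add_sum_erase _ (fun k => linForm (N k) ^ (2 * s)) (Finset.mem_univ j)
  rcases linForm_pow_sub_of_det2_eq_zero hs hd with ⟨w, hw⟩ | ⟨w, hw⟩
  · have := hasRep_of_finset (s := s) Finset.univ (Finset.univ.erase j) (Function.update P i w) N
    rw [Finset.card_erase_of_mem (Finset.mem_univ j),
      ← Finset.add_sum_erase _ _ (Finset.mem_univ i), Function.update_self, ← hw,
      Finset.sum_congr rfl fun k hk => by rw [Function.update_of_ne (Finset.ne_of_mem_erase hk)]]
      at this
    simp only [Finset.card_univ, Fintype.card_fin] at this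
    refine h.not_snd (b' := b - 1) (by have := j.2; omega) ?_
    convert this using 1
    rw [← hP, ← hN]
    ring
  · have := hasRep_of_finset (s := s) (Finset.univ.erase i) Finset.univ P (Function.update N j w)
    have hw' : linForm w ^ (2 * s) = linForm (N j) ^ (2 * s) - linForm (P i) ^ (2 * s) := by
      linear_combination hw
    rw [Finset.card_erase_of_mem (Finset.mem_univ i),
      ← Finset.add_sum_erase _ (fun k => linForm (Function.update N j w k) ^ (2 * s))
        (Finset.mem_univ j), Function.update_self, hw',
      Finset.sum_congr (g := fun k => linForm (N k) ^ (2 * s)) (s₁ := Finset.univ.erase j) rfl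
        fun k hk => by rw [Function.update_of_ne (Finset.ne_of_mem_erase hk)]]
      at this
    simp only [Finset.card_univ, Fintype.card_fin] at this
    refine h.not_fst (a' := a - 1) (by have := i.2; omega) ?_
    convert this using 1
    rw [← hP, ← hN]
    ring

theorem MinimalRep.right_ne_zero {s : ℕ} (hs : 1 ≤ s) {a b : ℕ} {P : Fin a → Fin 2 → ℝ}
    {N : Fin b → Fin 2 → ℝ}
    (h : MinimalRep s (∑ i, linForm (P i) ^ (2 * s) - ∑ j, linForm (N j) ^ (2 * s)) (a, b))
    (j : Fin b) : N j ≠ 0 := by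
  have h' := h.neg
  rw [neg_sub] at h'
  exact h'.left_ne_zero hs j

theorem MinimalRep.right_det2_ne_zero {s : ℕ} (hs : 1 ≤ s) {a b : ℕ} {P : Fin a → Fin 2 → ℝ}
    {N : Fin b → Fin 2 → ℝ}
    (h : MinimalRep s (∑ i, linForm (P i) ^ (2 * s) - ∑ j, linForm (N j) ^ (2 * s)) (a, b))
    {i j : Fin b} (hij : i ≠ j) : det2 (N i) (N j) ≠ 0 := by
  have h' := h.neg
  rw [neg_sub] at h'
  exact h'.left_det2_ne_zero hs hij

theorem hasRep_of_mem_badges {s : ℕ} (hs : 1 ≤ s) {p : MvPolynomial (Fin 2) ℝ} {ab : ℕ × ℕ}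
    (h : ab ∈ badges s p) : HasRep s p ab.1 ab.2 := by
  obtain ⟨r, lam, L, hrep, rfl⟩ := h
  have := HasRep.of_sum_weights hs (Finset.univ.filter fun j => 0 < lam j)
    (Finset.univ.filter fun j => lam j < 0) L L lam (fun j => -lam j)
    (fun i hi => (Finset.mem_filter.1 hi).2.le)
    (fun i hi => neg_nonneg.2 (Finset.mem_filter.1 hi).2.le)
  simp only [badge, Nat.card_eq_fintype_card, Fintype.card_subtype]
  convert this using 1
  rw [hrep.eq_sum, ← Finset.sum_filter_add_sum_filter_not _ (fun j => 0 < lam j),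
    sub_eq_add_neg, ← Finset.sum_neg_distrib]
  congr 1
  refine Finset.sum_congr ?_ fun j _ => by simp
  ext j
  simpa using ⟨fun h => lt_of_le_of_ne h (hrep.coeff_ne_zero j), le_of_lt⟩

theorem MinimalRep.mem_badges {s : ℕ} (hs : 1 ≤ s) {p : MvPolynomial (Fin 2) ℝ} {ab : ℕ × ℕ}
    (h : MinimalRep s p ab) : ab ∈ badges s p := by
  obtain ⟨a, b⟩ := ab
  obtain ⟨P, N, rfl⟩ := h.1
  simp only at P N h
  refine ⟨a + b, Fin.append (fun _ => 1) (fun _ => -1), Fin.append P N, ⟨?_, ?_, ?_, ?_⟩, ?_⟩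
  · intro j
    refine Fin.addCases (fun i => ?_) (fun i => ?_) j <;> simp
  · intro j
    refine Fin.addCases (fun i => ?_) (fun i => ?_) j
    · simpa using h.left_ne_zero hs i
    · simpa using h.right_ne_zero hs i
  · intro j k
    refine Fin.addCases (fun i => ?_) (fun i => ?_) j <;>
      refine Fin.addCases (fun l => ?_) (fun l => ?_) k <;> intro hne <;>
      simp only [Fin.append_left, Fin.append_right] <;>
      apply linearIndependent_of_det2_ne_zero
    · exact h.left_det2_ne_zero hs fun e => hne (by rw [e])
    · exact h.det2_ne_zero hs i l
    · rw [det2_swap]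
      exact neg_ne_zero.2 (h.det2_ne_zero hs l i)
    · exact h.right_det2_ne_zero hs fun e => hne (by rw [e])
  · simp [Fin.sum_univ_add, sub_eq_add_neg]
  · simp only [badge, Nat.card_eq_fintype_card, Fintype.card_subtype, Finset.card_filter,
      Fin.sum_univ_add]
    simp

/-- An honest badge gives a relaxed representation, and a minimal relaxed representation is honest
because a zero or proportional form would allow a count to drop. Hence both families have the same
minimal elements. -/
theorem mem_signatures_iff {s : ℕ} (hs : 1 ≤ s) {p : MvPolynomial (Fin 2) ℝ} {ab : ℕ × ℕ} :
    ab ∈ signatures s p ↔ MinimalRep s p ab := by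
  constructor
  · intro h
    refine ⟨hasRep_of_mem_badges hs h.1, fun cd hcd hle => ?_⟩
    obtain ⟨ef, hef, hmin⟩ := HasRep.exists_minimal hcd
    exact (h.2 (hmin.mem_badges hs) (hef.trans hle)).trans hef
  · intro h
    exact ⟨h.mem_badges hs, fun cd hcd hle => h.2 (hasRep_of_mem_badges hs hcd) hle⟩

theorem signatures_eq_singleton {s : ℕ} (hs : 1 ≤ s) {p : MvPolynomial (Fin 2) ℝ} {u v : ℕ}
    (h : HasRep s p u v) (hle : ∀ a b, HasRep s p a b → u ≤ a ∧ v ≤ b) :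
    signatures s p = {(u, v)} := by
  ext ⟨a, b⟩
  rw [mem_signatures_iff hs, Set.mem_singleton_iff]
  constructor
  · intro hab
    have h1 := hle a b hab.1
    exact le_antisymm (hab.2 (y := (u, v)) h ⟨h1.1, h1.2⟩) ⟨h1.1, h1.2⟩
  · rintro ⟨⟩
    exact ⟨h, fun cd hcd _ => ⟨(hle _ _ hcd).1, (hle _ _ hcd).2⟩⟩

/-! ### The apolar pairing -/

/-- The apolar pairing of the binary form of degree `n` with dehomogenization `g` against a
bivariate polynomial. -/
noncomputable def pairing (n : ℕ) (g : Polynomial ℝ) : MvPolynomial (Fin 2) ℝ →ₗ[ℝ] ℝ :=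
  ∑ k ∈ Finset.range (n + 1),
    (g.coeff k / (n.choose k : ℝ)) • lcoeff ℝ (Finsupp.single 0 k + Finsupp.single 1 (n - k))

/-- The value at `L` of the degree `n` homogenization of `f`. -/
noncomputable def hev (n : ℕ) (f : Polynomial ℝ) (L : Fin 2 → ℝ) : ℝ := eval L (f.homogenize n)

theorem hev_eq_sum (n : ℕ) (f : Polynomial ℝ) (L : Fin 2 → ℝ) :
    hev n f L = ∑ k ∈ Finset.range (n + 1), f.coeff k * (L 0 ^ k * L 1 ^ (n - k)) := by
  rw [hev, Polynomial.homogenize, map_sum, Finset.Nat.sum_antidiagonal_eq_sum_range_succ_mk]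
  refine Finset.sum_congr rfl fun k _ => ?_
  rw [Finsupp.update_eq_add_single (by simp), eval_monomial, Finsupp.prod_fintype _ _ (by simp)]
  simp

theorem hev_mul {m n : ℕ} {f g : Polynomial ℝ} (hf : f.natDegree ≤ m) (hg : g.natDegree ≤ n)
    (L : Fin 2 → ℝ) : hev (m + n) (f * g) L = hev m f L * hev n g L := by
  rw [hev, Polynomial.homogenize_mul _ _ hf hg, map_mul, hev, hev]

theorem hev_sq {n : ℕ} {f : Polynomial ℝ} (hf : f.natDegree ≤ n) (L : Fin 2 → ℝ) :
    hev (2 * n) (f ^ 2) L = hev n f L ^ 2 := by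
  rw [two_mul, sq, sq, hev_mul hf hf]

theorem hev_affine {n : ℕ} {f : Polynomial ℝ} (hf : f.natDegree ≤ n) (t : ℝ) :
    hev n f ![t, 1] = f.eval t := by
  have := Polynomial.aeval_homogenize_of_eq_one hf ![t, 1] rfl
  simpa [hev, Polynomial.aeval_def, Polynomial.eval₂_eq_eval_map, aeval_def] using this

theorem isHomogeneous_linForm {n : ℕ} (L : Fin n → ℝ) : (linForm L).IsHomogeneous 1 :=
  IsHomogeneous.sum _ _ 1 fun i _ => by
    simpa using (isHomogeneous_C (Fin n) (L i)).mul (isHomogeneous_X ℝ i)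

theorem coeff_linForm_pow {n k : ℕ} (hk : k ≤ n) (L : Fin 2 → ℝ) :
    coeff (Finsupp.single 0 k + Finsupp.single 1 (n - k)) (linForm L ^ n) =
      n.choose k * (L 0 ^ k * L 1 ^ (n - k)) := by
  have h : linForm L ^ n =
      (((Polynomial.C (L 0) * Polynomial.X + Polynomial.C (L 1)) ^ n : Polynomial ℝ)).homogenize n := by
    symm
    apply Polynomial.homogenize_eq_of_isHomogeneous
    · simpa using (isHomogeneous_linForm L).pow n
    · simp [linForm, Fin.sum_univ_two, Polynomial.C_eq_algebraMap]
  rw [h, Polynomial.coeff_homogenize]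
  have h0 : (Finsupp.single 0 k + Finsupp.single 1 (n - k) : Fin 2 →₀ ℕ) 0 = k := by simp
  have h1 : (Finsupp.single 0 k + Finsupp.single 1 (n - k) : Fin 2 →₀ ℕ) 1 = n - k := by simp
  rw [h0, h1, if_pos (by omega), add_pow, Polynomial.finsetSum_coeff, Finset.sum_eq_single k]
  · rw [mul_pow, ← Polynomial.C_pow, ← Polynomial.C_pow, ← Polynomial.C_eq_natCast, mul_assoc,
      mul_assoc, ← Polynomial.C_mul, Polynomial.coeff_C_mul, Polynomial.coeff_mul_C,
      Polynomial.coeff_X_pow_self]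
    ring
  · intro b _ hb
    rw [mul_pow, ← Polynomial.C_pow, ← Polynomial.C_pow, ← Polynomial.C_eq_natCast, mul_assoc,
      mul_assoc, ← Polynomial.C_mul, Polynomial.coeff_C_mul, Polynomial.coeff_mul_C,
      Polynomial.coeff_X_pow, if_neg (Ne.symm hb)]
    ring
  · intro h
    simp at h
    omega

/-- The binomial denominators in `pairing` cancel the binomial coefficients of the power, so a power
of `L` acts as evaluation at `L`. -/
theorem pairing_linForm_pow (n : ℕ) (g : Polynomial ℝ) (L : Fin 2 → ℝ) :
    pairing n g (linForm L ^ n) = hev n g L := by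
  rw [hev_eq_sum, pairing, LinearMap.sum_apply]
  refine Finset.sum_congr rfl fun k hk => ?_
  have hk' : k ≤ n := by simpa [Nat.lt_succ_iff] using hk
  have : (n.choose k : ℝ) ≠ 0 := by exact_mod_cast (Nat.choose_pos hk').ne'
  rw [LinearMap.smul_apply, lcoeff_apply, coeff_linForm_pow hk', smul_eq_mul]
  field_simp

theorem pairing_sq_sum {s : ℕ} {f : Polynomial ℝ} (hf : f.natDegree ≤ s) {ι : Type*}
    (t : Finset ι) (c : ι → ℝ) (P : ι → Fin 2 → ℝ) :
    pairing (2 * s) (f ^ 2) (∑ i ∈ t, C (c i) * linForm (P i) ^ (2 * s)) =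
      ∑ i ∈ t, c i * hev s f (P i) ^ 2 := by
  simp only [← smul_eq_C_mul, map_sum, map_smul, pairing_linForm_pow, hev_sq hf, smul_eq_mul]

theorem pairing_sq_rep {s : ℕ} {f : Polynomial ℝ} (hf : f.natDegree ≤ s) {a b : ℕ}
    (P : Fin a → Fin 2 → ℝ) (N : Fin b → Fin 2 → ℝ) :
    pairing (2 * s) (f ^ 2) (∑ i, linForm (P i) ^ (2 * s) - ∑ j, linForm (N j) ^ (2 * s)) =
      ∑ i, hev s f (P i) ^ 2 - ∑ j, hev s f (N j) ^ 2 := by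
  simp only [map_sub, map_sum, pairing_linForm_pow, hev_sq hf]

theorem exists_poly_forall_eq_zero {ι : Type*} [Fintype ι] {s : ℕ} (hι : Fintype.card ι ≤ s)
    (φ : ι → Polynomial ℝ →ₗ[ℝ] ℝ) :
    ∃ f : Polynomial ℝ, f ≠ 0 ∧ f.natDegree ≤ s ∧ ∀ i, φ i f = 0 := by
  let T : Polynomial.degreeLT ℝ (s + 1) →ₗ[ℝ] (ι → ℝ) :=
    (LinearMap.pi φ).comp (Polynomial.degreeLT ℝ (s + 1)).subtype
  have : Module.Finite ℝ (Polynomial.degreeLT ℝ (s + 1)) :=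
    Module.Finite.equiv (Polynomial.degreeLTEquiv ℝ (s + 1)).symm
  have hT : LinearMap.ker T ≠ ⊥ := by
    apply LinearMap.ker_ne_bot_of_finrank_lt
    rw [(Polynomial.degreeLTEquiv ℝ (s + 1)).finrank_eq]
    simpa using Nat.lt_succ_of_le hι
  obtain ⟨f, hf, hf0⟩ := (Submodule.ne_bot_iff _).1 hT
  refine ⟨f, by simpa using hf0, ?_, fun i => congrFun (LinearMap.mem_ker.1 hf) i⟩
  have := Polynomial.mem_degreeLT.1 f.2
  rw [Polynomial.natDegree_le_iff_degree_le]
  exact Order.le_of_lt_succ (by exact_mod_cast this)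

/-- Evaluation of the homogenization at `L`, as a linear functional. -/
noncomputable def hevLin (n : ℕ) (L : Fin 2 → ℝ) : Polynomial ℝ →ₗ[ℝ] ℝ :=
  (aeval L).toLinearMap.comp (Polynomial.homogenizeLM n)

theorem hevLin_apply (n : ℕ) (L : Fin 2 → ℝ) (f : Polynomial ℝ) : hevLin n L f = hev n f L := by
  simp [hevLin, hev]

/-- With at most `s` positive terms, some nonzero `f` of degree at most `s` vanishes at all of them.
Pairing with `f ^ 2` makes `∑ f(k)²` nonpositive, so `f` has `s + 1` roots. -/
theorem signatures_succ_zero {s : ℕ} (hs : 1 ≤ s) :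
    signatures s (∑ k : Fin (s + 1), linForm ![(k : ℝ), 1] ^ (2 * s)) = {(s + 1, 0)} := by
  apply signatures_eq_singleton hs
  · exact ⟨fun k => ![(k : ℝ), 1], Fin.elim0, by simp⟩
  · intro a b h
    refine ⟨?_, Nat.zero_le b⟩
    by_contra! ha
    obtain ⟨P, N, h⟩ := h
    obtain ⟨f, hf0, hf, hfP⟩ := exists_poly_forall_eq_zero (s := s) (ι := Fin a)
      (by simpa using Nat.lt_succ_iff.1 ha) fun i => hevLin s (P i)
    simp only [hevLin_apply] at hfP
    have h1 := congrArg (pairing (2 * s) (f ^ 2)) h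
    rw [pairing_sq_rep hf] at h1
    simp only [map_sum, pairing_linForm_pow, hev_sq hf, hev_affine hf, hfP] at h1
    have h2 : ∑ k : Fin (s + 1), f.eval (k : ℝ) ^ 2 = 0 := by
      apply le_antisymm
      · rw [h1]
        have : 0 ≤ ∑ j, hev s f (N j) ^ 2 := Finset.sum_nonneg fun _ _ => sq_nonneg _
        simpa using this
      · exact Finset.sum_nonneg fun _ _ => sq_nonneg _
    rw [Finset.sum_eq_zero_iff_of_nonneg fun _ _ => sq_nonneg _] at h2
    apply hf0
    refine Polynomial.eq_zero_of_natDegree_lt_card_of_eval_eq_zero f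
      (f := fun k : Fin (s + 1) => (k : ℝ)) ?_ (fun k => ?_) (by simpa using Nat.lt_succ_of_le hf)
    · intro i j hij
      exact Fin.ext (Nat.cast_injective hij)
    · exact pow_eq_zero_iff two_ne_zero |>.1 (h2 k (Finset.mem_univ k))

/-! ### The functional `Im g(i)` and the badges in the square -/

/-- The imaginary part of the value at `i` as a difference of two positive quadrature sums. -/
theorem exists_im_aeval_I_eq (s : ℕ) :
    ∃ c t : Fin s → ℝ, (∀ k, 0 < c k) ∧ Function.Injective t ∧
      ∀ g : Polynomial ℝ, g.natDegree ≤ 2 * s →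
        (Polynomial.aeval Complex.I g).im = ∑ k, c k * (g.eval (t k) - g.eval (-t k)) := by
  let v : Fin s → ℝ := fun k => ((k : ℝ) + 1) ^ 2
  have hv : Set.InjOn v (Finset.univ : Finset (Fin s)) := by
    intro i _ j _ hij
    have : (i : ℝ) + 1 = (j : ℝ) + 1 := by
      have := (sq_eq_sq₀ (by positivity) (by positivity)).1 hij
      exact this
    exact Fin.ext (by exact_mod_cast add_right_cancel this)
  -- Odd monomials satisfy `Im i^(2j+1) = (-1)^j`, so the task is to interpolate `X ^ j` at the
  -- squares `v k` and extrapolate to `-1`.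
  let l : Fin s → ℝ := fun k => (Lagrange.basis Finset.univ v k).eval (-1)
  have hl : ∀ k, l k ≠ 0 := by
    intro k
    have hne : ∀ i ∈ (Finset.univ : Finset (Fin s)), (-1 : ℝ) ≠ v i := fun i _ => by
      have : 0 ≤ v i := sq_nonneg _
      linarith
    simp only [l]
    rw [Lagrange.eval_basis_not_at_node (Finset.mem_univ k) (hne k (Finset.mem_univ k))]
    exact mul_ne_zero (Lagrange.eval_nodal_not_at_node hne)
      (mul_ne_zero (Lagrange.nodalWeight_ne_zero hv (Finset.mem_univ k))
        (inv_ne_zero (sub_ne_zero.2 (hne k (Finset.mem_univ k)))))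
  have hsum : ∀ j < s, ∑ k, l k * v k ^ j = (-1) ^ j := by
    intro j hj
    have := congrArg (Polynomial.eval (-1)) (Lagrange.eq_interpolate (f := Polynomial.X ^ j) hv
      (by rw [Polynomial.degree_X_pow]; simpa using hj))
    rw [Lagrange.interpolate_apply, Polynomial.eval_finsetSum] at this
    simp only [Polynomial.eval_pow, Polynomial.eval_X, Polynomial.eval_mul, Polynomial.eval_C] at this
    rw [this]
    exact Finset.sum_congr rfl fun k _ => mul_comm _ _
  let ε : Fin s → ℝ := fun k => SignType.sign (l k)
  have hε : ∀ k, ε k ^ 2 = 1 := by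
    intro k
    rcases lt_or_gt_of_ne (hl k) with h | h <;> simp [ε, h]
  have hεl : ∀ k, ε k * |l k| = l k := fun k => sign_mul_abs (l k)
  -- The sign of `l k` is moved into the node, which keeps the weight positive; even monomials
  -- cancel between `t k` and `-t k`.
  refine ⟨fun k => |l k| / (2 * (k + 1)), fun k => ε k * (k + 1), fun k => ?_, ?_, ?_⟩
  · have := abs_pos.2 (hl k)
    positivity
  · intro i j hij
    apply hv (Finset.mem_univ i) (Finset.mem_univ j)
    have := congrArg (· ^ 2) hij
    simpa only [mul_pow, hε, one_mul] using this
  · apply Polynomial.induction_with_natDegree_le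
    · simp
    · intro m r _ hm
      simp only [map_mul, map_pow, Polynomial.aeval_C, Polynomial.aeval_X, Polynomial.eval_mul,
        Polynomial.eval_C, Polynomial.eval_pow, Polynomial.eval_X, Complex.coe_algebraMap,
        Complex.im_ofReal_mul]
      rcases Nat.even_or_odd' m with ⟨j, rfl | rfl⟩
      · have h1 : (Complex.I ^ (2 * j)).im = 0 := by
          rw [pow_mul, Complex.I_sq, show (-1 : ℂ) = ((-1 : ℝ) : ℂ) by simp, ← Complex.ofReal_pow,
            Complex.ofReal_im]
        rw [h1, mul_zero]
        symm
        apply Finset.sum_eq_zero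
        intro k _
        rw [pow_mul, pow_mul, neg_sq]
        ring
      · have h1 : (Complex.I ^ (2 * j + 1)).im = (-1) ^ j := by
          rw [pow_succ, pow_mul, Complex.I_sq, show (-1 : ℂ) = ((-1 : ℝ) : ℂ) by simp,
            ← Complex.ofReal_pow, Complex.im_ofReal_mul, Complex.I_im, mul_one]
        rw [h1, ← hsum j (by omega), Finset.mul_sum]
        refine Finset.sum_congr rfl fun k _ => ?_
        have hk : (k : ℝ) + 1 ≠ 0 := by positivity
        rw [pow_succ, pow_succ, pow_mul, pow_mul, neg_sq, mul_pow, hε, one_mul]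
        nth_rewrite 1 [← hεl k]
        simp only [v]
        field_simp
        ring
    · intro f g _ _ hf hg
      simp only [map_add, Complex.add_im, Polynomial.eval_add, hf, hg, ← Finset.sum_add_distrib]
      exact Finset.sum_congr rfl fun k _ => by ring

/-- `f` has degree at most `n`, does not vanish at `i`, and is bounded on the real line in terms of
its value at `i` in the way a product of `n` real linear polynomials is. -/
def DominatedAtI (n : ℕ) (f : Polynomial ℝ) : Prop :=
  Polynomial.aeval Complex.I f ≠ 0 ∧
    ∀ t : ℝ, f.eval t ^ 2 ≤ (1 + t ^ 2) ^ n * Complex.normSq (Polynomial.aeval Complex.I f)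

theorem DominatedAtI.mul {m n : ℕ} {f g : Polynomial ℝ} (hf : DominatedAtI m f)
    (hg : DominatedAtI n g) : DominatedAtI (m + n) (f * g) := by
  refine ⟨by rw [map_mul]; exact mul_ne_zero hf.1 hg.1, fun t => ?_⟩
  rw [Polynomial.eval_mul, mul_pow, map_mul, Complex.normSq_mul, pow_add]
  calc _ ≤ _ := mul_le_mul (hf.2 t) (hg.2 t) (sq_nonneg _)
        (mul_nonneg (by positivity) (Complex.normSq_nonneg _))
    _ = _ := by ring

/-- The linear polynomial `m₀ X + m₁`. -/
noncomputable def linPoly (m : Fin 2 → ℝ) : Polynomial ℝ :=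
  Polynomial.C (m 0) * Polynomial.X + Polynomial.C (m 1)

theorem natDegree_linPoly_le (m : Fin 2 → ℝ) : (linPoly m).natDegree ≤ 1 :=
  Polynomial.natDegree_linear_le

theorem eval_linPoly (m : Fin 2 → ℝ) (t : ℝ) : (linPoly m).eval t = m 0 * t + m 1 := by
  simp [linPoly]

theorem aeval_I_linPoly (m : Fin 2 → ℝ) :
    Polynomial.aeval Complex.I (linPoly m) = m 0 * Complex.I + m 1 := by
  simp [linPoly]

theorem hev_linPoly (m L : Fin 2 → ℝ) : hev 1 (linPoly m) L = m 0 * L 0 + m 1 * L 1 := by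
  simp [hev_eq_sum, linPoly, Finset.sum_range_succ, Polynomial.coeff_C]
  ring

/-- The bound is Cauchy–Schwarz for `(m 0, m 1)` and `(t, 1)`. -/
theorem dominatedAtI_linPoly {m : Fin 2 → ℝ} (hm : m ≠ 0) : DominatedAtI 1 (linPoly m) := by
  constructor
  · rw [aeval_I_linPoly]
    intro h
    apply hm
    have h0 := congrArg Complex.im h
    have h1 := congrArg Complex.re h
    ext i
    fin_cases i
    · simpa using h0
    · simpa using h1
  · intro t
    rw [aeval_I_linPoly, eval_linPoly, Complex.normSq_apply]
    simp only [Complex.add_re, Complex.mul_re, Complex.ofReal_re, Complex.I_re, mul_zero,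
      Complex.ofReal_im, Complex.I_im, mul_one, sub_self, zero_add, Complex.add_im, Complex.mul_im,
      add_zero, pow_one]
    nlinarith [sq_nonneg (m 0 - m 1 * t)]

theorem dominatedAtI_prod_linPoly {ι : Type*} (u : Finset ι) {m : ι → Fin 2 → ℝ}
    (hm : ∀ i, m i ≠ 0) : DominatedAtI u.card (∏ i ∈ u, linPoly (m i)) := by
  classical
  induction u using Finset.induction_on with
  | empty => simp [DominatedAtI]
  | insert i u hi ih =>
    rw [Finset.prod_insert hi, Finset.card_insert_of_notMem hi, add_comm]
    exact (dominatedAtI_linPoly (hm i)).mul ih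

theorem natDegree_prod_linPoly_le {ι : Type*} (u : Finset ι) (m : ι → Fin 2 → ℝ) :
    (∏ i ∈ u, linPoly (m i)).natDegree ≤ u.card :=
  (Polynomial.natDegree_prod_le _ _).trans <| by
    simpa using Finset.sum_le_sum fun i (_ : i ∈ u) => natDegree_linPoly_le (m i)

theorem hev_prod_linPoly_eq_zero {ι : Type*} {u : Finset ι} {m : ι → Fin 2 → ℝ} {s : ℕ}
    (hs : u.card ≤ s) {i : ι} (hi : i ∈ u) {L : Fin 2 → ℝ}
    (h : m i 0 * L 0 + m i 1 * L 1 = 0) : hev s (∏ i ∈ u, linPoly (m i)) L = 0 := by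
  classical
  have hpos : 0 < u.card := Finset.card_pos.2 ⟨i, hi⟩
  obtain ⟨r, rfl⟩ : ∃ r, s = 1 + r := ⟨s - 1, by omega⟩
  rw [← Finset.mul_prod_erase _ _ hi, hev_mul (natDegree_linPoly_le _)
    ((natDegree_prod_linPoly_le _ _).trans (by rw [Finset.card_erase_of_mem hi]; omega)),
    hev_linPoly, h, zero_mul]

theorem exists_ne_zero_dot_eq_zero (L : Fin 2 → ℝ) :
    ∃ m : Fin 2 → ℝ, m ≠ 0 ∧ m 0 * L 0 + m 1 * L 1 = 0 := by
  by_cases hL : L = 0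
  · exact ⟨![1, 0], fun h => by simpa using congrFun h 0, by simp [hL]⟩
  · refine ⟨![L 1, -L 0], fun h => hL ?_, by simp; ring⟩
    have h0 := congrFun h 0
    have h1 := congrFun h 1
    ext i
    fin_cases i
    · simpa using h1
    · simpa using h0

/-- Multiplying by a suitable real linear polynomial rotates the value at `i` onto the ray spanned
by `1 - i`. -/
theorem exists_linPoly_im_sq {g : Polynomial ℝ} (hg : Polynomial.aeval Complex.I g ≠ 0) :
    ∃ m : Fin 2 → ℝ, m ≠ 0 ∧ (Polynomial.aeval Complex.I (linPoly m * g) ^ 2).im =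
      -Complex.normSq (Polynomial.aeval Complex.I (linPoly m * g)) := by
  set w := Polynomial.aeval Complex.I g
  -- These coefficients make the linear factor equal to `(1 - i)` times the conjugate of `w` at `i`.
  refine ⟨![w.im * -1 + w.re * -1, w.re - w.im], fun h => hg ?_, ?_⟩
  · have h0 := congrFun h 0
    have h1 := congrFun h 1
    simp at h0 h1
    apply Complex.ext <;> simp <;> linarith
  · rw [map_mul, aeval_I_linPoly, Complex.normSq_apply]
    simp only [sq, Complex.mul_im, Complex.mul_re, Complex.add_re, Complex.add_im,
      Complex.ofReal_re, Complex.ofReal_im, Complex.I_re, Complex.I_im, Matrix.cons_val_zero,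
      Matrix.cons_val_one, w]
    ring

theorem HasRep.of_fin_weights {s : ℕ} (hs : 1 ≤ s) {u v : ℕ} (hu : u ≤ s) (hv : v ≤ s)
    (P N : Fin s → Fin 2 → ℝ) (c d : Fin s → ℝ) (hc : ∀ k, 0 ≤ c k) (hd : ∀ k, 0 ≤ d k)
    (hcu : ∀ k : Fin s, u ≤ k → c k = 0) (hdv : ∀ k : Fin s, v ≤ k → d k = 0) :
    HasRep s (∑ k, C (c k) * linForm (P k) ^ (2 * s) -
      ∑ k, C (d k) * linForm (N k) ^ (2 * s)) u v := by
  have := HasRep.of_sum_weights hs (Finset.univ.filter fun k : Fin s => (k : ℕ) < u)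
    (Finset.univ.filter fun k : Fin s => (k : ℕ) < v) P N c d (fun k _ => hc k) (fun k _ => hd k)
  rw [Finset.sum_filter_of_ne, Finset.sum_filter_of_ne] at this
  · simpa [Fin.card_filter_val_lt, hu, hv] using this
  · intro k _ hk
    by_contra! h
    exact hk (by rw [hdv k h, C_0, zero_mul])
  · intro k _ hk
    by_contra! h
    exact hk (by rw [hcu k h, C_0, zero_mul])

section TwoSidedQuadrature

variable {s : ℕ} {c t e d : Fin s → ℝ}

/-- The quadratic form of a signed measure obtained from the quadrature for `g ↦ Im g(i)` by
lowering the positive weights to `e` and the negative weights to `d`. -/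
theorem pairing_sq_quadrature
    (hq : ∀ g : Polynomial ℝ, g.natDegree ≤ 2 * s →
      (Polynomial.aeval Complex.I g).im = ∑ k, c k * (g.eval (t k) - g.eval (-t k)))
    {f : Polynomial ℝ} (hf : f.natDegree ≤ s) :
    pairing (2 * s) (f ^ 2) (∑ k, C (e k) * linForm ![t k, 1] ^ (2 * s) -
      ∑ k, C (d k) * linForm ![-t k, 1] ^ (2 * s)) =
      (Polynomial.aeval Complex.I f ^ 2).im - ∑ k, (c k - e k) * f.eval (t k) ^ 2 +
        ∑ k, (c k - d k) * f.eval (-t k) ^ 2 := by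
  have h := hq (f ^ 2) (Polynomial.natDegree_pow_le.trans (Nat.mul_le_mul_left 2 hf))
  rw [map_pow] at h
  rw [map_sub, pairing_sq_sum hf, pairing_sq_sum hf, h, ← Finset.sum_sub_distrib,
    ← Finset.sum_sub_distrib, ← Finset.sum_add_distrib]
  refine Finset.sum_congr rfl fun k _ => ?_
  rw [hev_affine hf, hev_affine hf, Polynomial.eval_pow, Polynomial.eval_pow]
  ring

/-- If `a < u`, there is room for a nonzero `f` that vanishes at the `a` positive forms and at the
`s - u` dropped nodes and satisfies `Re f(i) = Im f(i)`, so that `Im f(i)² ≥ 0`. The pairing is then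
both nonpositive and a sum of nonnegative terms. Since each `c k - d k` is strictly positive, `f`
vanishes at `i` and at all `s` nodes `-t k`, too many zeros for its degree. -/
theorem le_of_hasRep_quadrature_left {u a b : ℕ} (htinj : Function.Injective t)
    (hq : ∀ g : Polynomial ℝ, g.natDegree ≤ 2 * s →
      (Polynomial.aeval Complex.I g).im = ∑ k, c k * (g.eval (t k) - g.eval (-t k)))
    (hu : u ≤ s) (he : ∀ k : Fin s, (k : ℕ) < u → e k = c k) (hd : ∀ k, d k < c k)
    (h : HasRep s (∑ k, C (e k) * linForm ![t k, 1] ^ (2 * s) -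
      ∑ k, C (d k) * linForm ![-t k, 1] ^ (2 * s)) a b) : u ≤ a := by
  by_contra! ha
  obtain ⟨P, N, h⟩ := h
  have hcard : Fintype.card (Fin a ⊕ Fin (s - u) ⊕ Unit) ≤ s := by
    simp only [Fintype.card_sum, Fintype.card_fin, Fintype.card_unit]
    omega
  have hlt : ∀ k : Fin (s - u), u + k < s := fun k => by omega
  obtain ⟨f, hf0, hf, hfv⟩ := exists_poly_forall_eq_zero hcard
    (Sum.elim (fun i => hevLin s (P i)) (Sum.elim (fun k => Polynomial.leval (t ⟨u + k, hlt k⟩))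
      (fun _ => (Complex.reLm - Complex.imLm).comp
        (Polynomial.aeval (R := ℝ) Complex.I).toLinearMap)))
  have hfP : ∀ i, hev s f (P i) = 0 := fun i => by simpa [hevLin_apply] using hfv (Sum.inl i)
  have hft : ∀ k : Fin s, u ≤ k → f.eval (t k) = 0 := fun k hk => by
    have := hfv (Sum.inr (Sum.inl ⟨k - u, by omega⟩))
    simpa [Nat.add_sub_cancel' hk] using this
  have hfI : (Polynomial.aeval Complex.I f).re = (Polynomial.aeval Complex.I f).im := by
    have := hfv (Sum.inr (Sum.inr ()))
    simpa [sub_eq_zero] using this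
  have h1 := congrArg (pairing (2 * s) (f ^ 2)) h
  rw [pairing_sq_rep hf, pairing_sq_quadrature hq hf] at h1
  have hz1 : ∑ k, (c k - e k) * f.eval (t k) ^ 2 = 0 := by
    refine Finset.sum_eq_zero fun k _ => ?_
    rcases lt_or_ge (k : ℕ) u with hk | hk
    · rw [he k hk, sub_self, zero_mul]
    · rw [hft k hk]; ring
  have hz2 : ∑ i, hev s f (P i) ^ 2 = 0 :=
    Finset.sum_eq_zero fun i _ => by rw [hfP]; ring
  have hn1 : 0 ≤ ∑ j, hev s f (N j) ^ 2 := Finset.sum_nonneg fun _ _ => sq_nonneg _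
  have hnn : ∀ k ∈ Finset.univ, 0 ≤ (c k - d k) * f.eval (-t k) ^ 2 := fun k _ =>
    mul_nonneg (sub_nonneg.2 (hd k).le) (sq_nonneg _)
  have hn2 := Finset.sum_nonneg hnn
  have hI : (Polynomial.aeval Complex.I f ^ 2).im = 2 * (Polynomial.aeval Complex.I f).re ^ 2 := by
    rw [sq, Complex.mul_im, ← hfI]; ring
  rw [hz1, hz2, hI] at h1
  have hre : (Polynomial.aeval Complex.I f).re = 0 := by
    have := sq_nonneg (Polynomial.aeval Complex.I f).re
    exact pow_eq_zero_iff two_ne_zero |>.1 (by linarith)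
  have hI0 : Polynomial.aeval Complex.I f = 0 := Complex.ext hre (hfI ▸ hre)
  have hs0 : ∑ k, (c k - d k) * f.eval (-t k) ^ 2 = 0 := by
    rw [hre] at h1
    linarith
  rw [Finset.sum_eq_zero_iff_of_nonneg hnn] at hs0
  have hroot : ∀ k, f.eval (-t k) = 0 := fun k =>
    pow_eq_zero_iff two_ne_zero |>.1
      ((mul_eq_zero.1 (hs0 k (Finset.mem_univ k))).resolve_left (sub_pos.2 (hd k)).ne')
  obtain ⟨q, hfq⟩ := Polynomial.quadratic_dvd_of_aeval_eq_zero_im_ne_zero f hI0 (by simp)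
  have hquad : (Polynomial.X ^ 2 - Polynomial.C (2 * Complex.I.re) * Polynomial.X +
      Polynomial.C (‖Complex.I‖ ^ 2) : Polynomial ℝ) = Polynomial.X ^ 2 + Polynomial.C 1 := by simp
  rw [hquad] at hfq
  have hq0 : q ≠ 0 := by
    rintro rfl
    exact hf0 (by rw [hfq, mul_zero])
  have hdeg : q.natDegree + 2 ≤ s := by
    rw [hfq, Polynomial.natDegree_mul (Polynomial.X_pow_add_C_ne_zero two_pos _) hq0,
      Polynomial.natDegree_X_pow_add_C] at hf
    omega
  apply hq0
  refine Polynomial.eq_zero_of_natDegree_lt_card_of_eval_eq_zero q (f := fun k => -t k)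
    (fun i j hij => htinj (neg_injective hij)) (fun k => ?_) (by simp; omega)
  have := hroot k
  rw [hfq, Polynomial.eval_mul] at this
  refine (mul_eq_zero.1 this).resolve_left ?_
  simp only [Polynomial.eval_add, Polynomial.eval_pow, Polynomial.eval_X, Polynomial.eval_C]
  positivity

/-- If `b < v`, take `f` to be a product of real linear factors vanishing at the `b` negative forms
and the `s - v` dropped nodes, with one more factor making `Im f(i)² = -|f(i)|²`. The product shape
bounds `f(-t k)²` by a multiple of `|f(i)|²`, so the defect caused by `δ` is less than `|f(i)|²` and
the pairing is negative, although it should be a sum of squares. -/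
theorem le_of_hasRep_quadrature_right {v a b : ℕ} {δ : ℝ} (hc : ∀ k, 0 < c k)
    (hq : ∀ g : Polynomial ℝ, g.natDegree ≤ 2 * s →
      (Polynomial.aeval Complex.I g).im = ∑ k, c k * (g.eval (t k) - g.eval (-t k)))
    (hv : v ≤ s) (he : ∀ k, e k ≤ c k) (hd : ∀ k : Fin s, (k : ℕ) < v → d k = (1 - δ) * c k)
    (hδ : 0 ≤ δ) (hδ1 : δ * ∑ k, c k * (1 + t k ^ 2) ^ s < 1)
    (h : HasRep s (∑ k, C (e k) * linForm ![t k, 1] ^ (2 * s) -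
      ∑ k, C (d k) * linForm ![-t k, 1] ^ (2 * s)) a b) : v ≤ b := by
  by_contra! hb
  obtain ⟨P, N, h⟩ := h
  choose n hn0 hn using fun j => exists_ne_zero_dot_eq_zero (N j)
  have hlt : ∀ k : Fin (s - v), v + k < s := fun k => by omega
  let m₀ : Fin b ⊕ Fin (s - v) → Fin 2 → ℝ :=
    Sum.elim n (fun k => ![1, t ⟨v + k, hlt k⟩])
  have hm₀ : ∀ i, m₀ i ≠ 0 := by
    rintro (j | k)
    · exact hn0 j
    · exact fun h => by simpa [m₀] using congrFun h 0
  obtain ⟨l, hl0, hl⟩ := exists_linPoly_im_sq (dominatedAtI_prod_linPoly Finset.univ hm₀).1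
  let m : Option (Fin b ⊕ Fin (s - v)) → Fin 2 → ℝ := fun i => i.elim l m₀
  have hm : ∀ i, m i ≠ 0 := by
    rintro (_ | i)
    · exact hl0
    · exact hm₀ i
  have hcard : (Finset.univ : Finset (Option (Fin b ⊕ Fin (s - v)))).card ≤ s := by
    simp only [Finset.card_univ, Fintype.card_option, Fintype.card_sum, Fintype.card_fin]
    omega
  set f := ∏ i, linPoly (m i) with hfdef
  have hfI : (Polynomial.aeval Complex.I f ^ 2).im =
      -Complex.normSq (Polynomial.aeval Complex.I f) := by
    rw [hfdef, Fintype.prod_option]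
    exact hl
  have hf : f.natDegree ≤ s := (natDegree_prod_linPoly_le _ _).trans hcard
  obtain ⟨hfI0, hdom⟩ := dominatedAtI_prod_linPoly Finset.univ hm
  rw [← hfdef] at hfI0 hdom
  have hS : 0 < Complex.normSq (Polynomial.aeval Complex.I f) := Complex.normSq_pos.2 hfI0
  have hfN : ∀ j, hev s f (N j) = 0 := fun j =>
    hev_prod_linPoly_eq_zero hcard (Finset.mem_univ (some (Sum.inl j))) (hn j)
  have hft : ∀ k : Fin s, v ≤ k → f.eval (-t k) = 0 := fun k hk => by
    rw [hfdef, Polynomial.eval_prod]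
    refine Finset.prod_eq_zero (Finset.mem_univ (some (Sum.inr ⟨k - v, by omega⟩))) ?_
    simp [m, m₀, eval_linPoly, Nat.add_sub_cancel' hk]
  have h1 := congrArg (pairing (2 * s) (f ^ 2)) h
  rw [pairing_sq_rep hf, pairing_sq_quadrature hq hf, hfI] at h1
  have hz : ∑ j, hev s f (N j) ^ 2 = 0 := Finset.sum_eq_zero fun i _ => by rw [hfN]; ring
  have hn1 : 0 ≤ ∑ j, hev s f (P j) ^ 2 := Finset.sum_nonneg fun _ _ => sq_nonneg _
  have hn2 : 0 ≤ ∑ k, (c k - e k) * f.eval (t k) ^ 2 :=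
    Finset.sum_nonneg fun k _ => mul_nonneg (sub_nonneg.2 (he k)) (sq_nonneg _)
  have hbound : ∑ k, (c k - d k) * f.eval (-t k) ^ 2 ≤
      (δ * ∑ k, c k * (1 + t k ^ 2) ^ s) * Complex.normSq (Polynomial.aeval Complex.I f) := by
    rw [Finset.mul_sum, Finset.sum_mul]
    refine Finset.sum_le_sum fun k _ => ?_
    have hck := hc k
    rcases lt_or_ge (k : ℕ) v with hk | hk
    · rw [hd k hk]
      have h2 : f.eval (-t k) ^ 2 ≤
          (1 + t k ^ 2) ^ s * Complex.normSq (Polynomial.aeval Complex.I f) := by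
        refine (hdom (-t k)).trans ?_
        rw [neg_sq]
        exact mul_le_mul_of_nonneg_right
          (pow_le_pow_right₀ (by nlinarith [sq_nonneg (t k)]) hcard) hS.le
      calc _ = δ * c k * f.eval (-t k) ^ 2 := by ring
        _ ≤ δ * c k * _ := mul_le_mul_of_nonneg_left h2 (by positivity)
        _ = _ := by ring
    · rw [hft k hk]
      have : 0 ≤ δ * (c k * (1 + t k ^ 2) ^ s) *
        Complex.normSq (Polynomial.aeval Complex.I f) := by positivity
      simpa using this
  nlinarith

end TwoSidedQuadrature

theorem exists_signatures_eq_of_le {s : ℕ} (hs : 1 ≤ s) {u v : ℕ} (hu : u ≤ s) (hv : v ≤ s) :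
    ∃ p ∈ F 2 (2 * s), signatures s p = {(u, v)} := by
  obtain ⟨c, t, hc, ht, hq⟩ := exists_im_aeval_I_eq s
  -- Positivity of `δ` gives the strict inequality needed for the bound on positive terms; `δ * K <
  -- 1` serves the bound on negative terms.
  set K := ∑ k, c k * (1 + t k ^ 2) ^ s
  have hK : 0 ≤ K := Finset.sum_nonneg fun k _ => by have := hc k; positivity
  set δ := 1 / (1 + K) with hδdef
  have hδ : 0 < δ := by positivity
  have hδ1 : δ ≤ 1 := by
    rw [hδdef, div_le_one (by positivity)]
    linarith
  have hδK : δ * K < 1 := by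
    rw [hδdef, one_div_mul_eq_div, div_lt_one (by positivity)]
    linarith
  refine ⟨∑ k : Fin s, C (if (k : ℕ) < u then c k else 0) * linForm ![t k, 1] ^ (2 * s) -
    ∑ k : Fin s, C (if (k : ℕ) < v then (1 - δ) * c k else 0) * linForm ![-t k, 1] ^ (2 * s), ?_, ?_⟩
  · have hmem : ∀ (x : ℝ) (L : Fin 2 → ℝ), C x * linForm L ^ (2 * s) ∈ F 2 (2 * s) := fun x L => by
      rw [← smul_eq_C_mul]
      refine Submodule.smul_mem _ _ ?_
      simpa using (isHomogeneous_linForm L).pow (2 * s)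
    exact Submodule.sub_mem _ (Submodule.sum_mem _ fun _ _ => hmem _ _)
      (Submodule.sum_mem _ fun _ _ => hmem _ _)
  · refine signatures_eq_singleton hs ?_ fun a b h => ⟨?_, ?_⟩
    · refine HasRep.of_fin_weights hs hu hv _ _ _ _ (fun k => ?_) (fun k => ?_) (fun k hk => ?_)
        (fun k hk => ?_)
      · split_ifs
        exacts [(hc k).le, le_rfl]
      · split_ifs
        exacts [mul_nonneg (sub_nonneg.2 hδ1) (hc k).le, le_rfl]
      · exact if_neg (not_lt.2 hk)
      · exact if_neg (not_lt.2 hk)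
    · refine le_of_hasRep_quadrature_left ht hq hu (fun k hk => if_pos hk) (fun k => ?_) h
      have := hc k
      split_ifs
      · nlinarith
      · exact this
    · refine le_of_hasRep_quadrature_right hc hq hv (fun k => ?_) (fun k hk => if_pos hk) hδ.le
        hδK h
      split_ifs
      exacts [le_rfl, (hc k).le]

/-! ### Orthogonal polynomials and Gauss quadrature -/

section DiscreteMeasure

variable {ι : Type*} [Fintype ι]

/-- The positive definite sum `∑ λᵢ f(tᵢ)` over more nodes than the degree vanishes on squares only
at zero. -/
theorem eq_zero_of_sum_weight_mul_nonpos {lam t : ι → ℝ} (hlam : ∀ i, 0 < lam i)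
    (ht : Function.Injective t) {g : Polynomial ℝ} (hg : g.natDegree < Fintype.card ι)
    {q : Polynomial ℝ} (hq : ∀ x, 0 ≤ q.eval x)
    (hqg : ∀ i, q.eval (t i) = 0 → g.eval (t i) = 0) {r : Polynomial ℝ}
    (hr : ∀ i, r.eval (t i) = 0 → g.eval (t i) = 0)
    (h : ∑ i, lam i * (q.eval (t i) * r.eval (t i) ^ 2) ≤ 0) : g = 0 := by
  have hnn : ∀ i ∈ Finset.univ, 0 ≤ lam i * (q.eval (t i) * r.eval (t i) ^ 2) := fun i _ =>
    mul_nonneg (hlam i).le (mul_nonneg (hq _) (sq_nonneg _))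
  have h0 := (Finset.sum_eq_zero_iff_of_nonneg hnn).1 (le_antisymm h (Finset.sum_nonneg hnn))
  refine Polynomial.eq_zero_of_natDegree_lt_card_of_eval_eq_zero g ht (fun i => ?_) hg
  rcases mul_eq_zero.1 ((mul_eq_zero.1 (h0 i (Finset.mem_univ i))).resolve_left (hlam i).ne')
    with h | h
  · exact hqg i h
  · exact hr i (pow_eq_zero_iff two_ne_zero |>.1 h)

/-- In degree below `s`, `f` would be orthogonal to itself, hence zero at more nodes than its
degree. -/
theorem natDegree_eq_of_orthogonal {s : ℕ} {lam t : ι → ℝ} (hlam : ∀ i, 0 < lam i)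
    (ht : Function.Injective t) (hcard : s < Fintype.card ι) {f : Polynomial ℝ} (hf0 : f ≠ 0)
    (hf : f.natDegree ≤ s)
    (horth : ∀ g : Polynomial ℝ, g.natDegree < s →
      ∑ i, lam i * (f.eval (t i) * g.eval (t i)) = 0) : f.natDegree = s := by
  by_contra hne
  apply hf0
  refine eq_zero_of_sum_weight_mul_nonpos hlam ht (q := 1) (r := f) (by omega) (by simp) (by simp)
    (fun i h => h) ?_
  have := horth f (by omega)
  simpa [sq] using this.le

/-- A polynomial orthogonal to all polynomials of smaller degree has no divisor of degree two that
is nonnegative on the real line. -/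
theorem not_dvd_of_orthogonal {s : ℕ} {lam t : ι → ℝ} (hlam : ∀ i, 0 < lam i)
    (ht : Function.Injective t) (hcard : s < Fintype.card ι) {f : Polynomial ℝ} (hf0 : f ≠ 0)
    (hf : f.natDegree ≤ s)
    (horth : ∀ g : Polynomial ℝ, g.natDegree < s →
      ∑ i, lam i * (f.eval (t i) * g.eval (t i)) = 0)
    {q : Polynomial ℝ} (hq : ∀ x, 0 ≤ q.eval x) (hqd : 0 < q.natDegree) : ¬ q ∣ f := by
  rintro ⟨r, rfl⟩
  have hr0 : r ≠ 0 := right_ne_zero_of_mul hf0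
  have hq0 : q ≠ 0 := left_ne_zero_of_mul hf0
  apply hf0
  refine eq_zero_of_sum_weight_mul_nonpos hlam ht (q := q) (r := r) (by omega) hq
    (fun i h => by rw [Polynomial.eval_mul, h, zero_mul])
    (fun i h => by rw [Polynomial.eval_mul, h, mul_zero]) ?_
  -- Orthogonality of `f = q * r` to the cofactor `r` is the vanishing of the sum of `q * r ^ 2`.
  have := horth r (by rw [Polynomial.natDegree_mul hq0 hr0] at hf; omega)
  refine le_of_eq ?_
  rw [← this]
  refine Finset.sum_congr rfl fun i _ => ?_
  rw [Polynomial.eval_mul]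
  ring

/-- A nonreal root `z` yields the divisor `(X - z)(X - z̄)`, and a repeated root `x` yields `(X -
x)²`; both are nonnegative on the line. -/
theorem splits_and_nodup_of_orthogonal {s : ℕ} {lam t : ι → ℝ} (hlam : ∀ i, 0 < lam i)
    (ht : Function.Injective t) (hcard : s < Fintype.card ι) {f : Polynomial ℝ} (hf0 : f ≠ 0)
    (hf : f.natDegree ≤ s)
    (horth : ∀ g : Polynomial ℝ, g.natDegree < s →
      ∑ i, lam i * (f.eval (t i) * g.eval (t i)) = 0) : f.Splits ∧ f.roots.Nodup := by
  have hnd := fun q => not_dvd_of_orthogonal hlam ht hcard hf0 hf horth (q := q)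
  constructor
  · apply Polynomial.Splits.of_splits_map_of_injective (i := algebraMap ℝ ℂ)
      (algebraMap ℝ ℂ).injective (IsAlgClosed.splits _)
    intro z hz
    have hz' : Polynomial.aeval z f = 0 := by
      rw [Polynomial.mem_roots'] at hz
      rw [Polynomial.aeval_def, Polynomial.eval₂_eq_eval_map]
      exact hz.2
    by_contra hreal
    have him : z.im ≠ 0 := fun h => hreal ⟨z.re, Complex.ext (by simp) (by simp [h])⟩
    refine hnd _ (fun x => ?_) ?_ (Polynomial.quadratic_dvd_of_aeval_eq_zero_im_ne_zero f hz' him)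
    · simp only [Polynomial.eval_add, Polynomial.eval_sub, Polynomial.eval_pow, Polynomial.eval_X,
        Polynomial.eval_mul, Polynomial.eval_C, Complex.sq_norm, Complex.normSq_apply]
      nlinarith [sq_nonneg (x - z.re), sq_nonneg z.im]
    · have : (Polynomial.X ^ 2 - Polynomial.C (2 * z.re) * Polynomial.X +
        Polynomial.C (‖z‖ ^ 2) : Polynomial ℝ).natDegree = 2 := by compute_degree!
      omega
  · rw [Multiset.nodup_iff_count_le_one]
    intro x
    by_contra! h
    rw [Polynomial.count_roots] at h
    refine hnd ((Polynomial.X - Polynomial.C x) ^ 2) (fun y => ?_) ?_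
      ((Polynomial.le_rootMultiplicity_iff hf0).1 h)
    · simpa using sq_nonneg (y - x)
    · rw [Polynomial.natDegree_pow, Polynomial.natDegree_X_sub_C]
      omega

end DiscreteMeasure

/-- Gauss quadrature: a positive measure on `s + 1` points agrees on polynomials of degree at most
`2 s` with one on `s` points together with a nonnegative multiple of the top coefficient. -/
theorem exists_gauss_quadrature {s : ℕ} (hs : 1 ≤ s) {lam t : Fin (s + 1) → ℝ}
    (hlam : ∀ i, 0 < lam i) (ht : Function.Injective t) :
    ∃ (w τ : Fin s → ℝ) (ν : ℝ), (∀ j, 0 ≤ w j) ∧ 0 ≤ ν ∧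
      ∀ g : Polynomial ℝ, g.natDegree ≤ 2 * s →
        ∑ i, lam i * g.eval (t i) = ∑ j, w j * g.eval (τ j) + ν * g.coeff (2 * s) := by
  -- Orthogonality to `1, X, …, X^(s-1)` is `s` conditions on `s + 1` coefficients.
  obtain ⟨f, hf0, hf, horth'⟩ := exists_poly_forall_eq_zero (s := s) (ι := Fin s) (by simp)
    fun k => ∑ i, (lam i * t i ^ (k : ℕ)) • Polynomial.leval (t i)
  have horth : ∀ g : Polynomial ℝ, g.natDegree < s →
      ∑ i, lam i * (f.eval (t i) * g.eval (t i)) = 0 := by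
    intro g hg
    have : ∀ i, lam i * (f.eval (t i) * g.eval (t i)) =
        ∑ k : Fin s, g.coeff k * (lam i * t i ^ (k : ℕ) * f.eval (t i)) := by
      intro i
      rw [Polynomial.eval_eq_sum_range' hg, ← Fin.sum_univ_eq_sum_range
        (fun k => g.coeff k * t i ^ k), Finset.mul_sum, Finset.mul_sum]
      exact Finset.sum_congr rfl fun k _ => by ring
    simp only [this]
    rw [Finset.sum_comm]
    refine Finset.sum_eq_zero fun k _ => ?_
    rw [← Finset.mul_sum]
    have := horth' k
    simp only [LinearMap.sum_apply, LinearMap.smul_apply, Polynomial.leval_apply,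
      smul_eq_mul] at this
    rw [this, mul_zero]
  have hcard : s < Fintype.card (Fin (s + 1)) := by simp
  have hdeg := natDegree_eq_of_orthogonal hlam ht hcard hf0 hf horth
  obtain ⟨hsplit, hnodup⟩ := splits_and_nodup_of_orthogonal hlam ht hcard hf0 hf horth
  have hroots : f.roots.toFinset.card = s := by
    rw [Multiset.toFinset_card_of_nodup hnodup, ← hsplit.natDegree_eq_card_roots, hdeg]
  let τ : Fin s → ℝ := fun j => (f.roots.toFinset.equivFinOfCardEq hroots).symm j
  have hτinj : Set.InjOn τ (Finset.univ : Finset (Fin s)) := fun i _ j _ hij =>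
    (f.roots.toFinset.equivFinOfCardEq hroots).symm.injective (Subtype.ext hij)
  have hτ : ∀ j, f.eval (τ j) = 0 := fun j =>
    (Polynomial.mem_roots'.1 (Multiset.mem_toFinset.1
      ((f.roots.toFinset.equivFinOfCardEq hroots).symm j).2)).2
  let l : Fin s → Polynomial ℝ := Lagrange.basis Finset.univ τ
  let w : Fin s → ℝ := fun j => ∑ i, lam i * (l j).eval (t i)
  have hlow : ∀ g : Polynomial ℝ, g.natDegree < 2 * s →
      ∑ i, lam i * g.eval (t i) = ∑ j, w j * g.eval (τ j) := by
    intro g hg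
    -- In `g = f Q + r` the term `f Q` integrates to zero since `deg Q < s`, and `r` is recovered by
    -- interpolation at the roots of `f`.
    have hdm := EuclideanDomain.div_add_mod g f
    set Q := g / f
    set r := g % f
    have hrdeg : r.degree < s := by
      have := Polynomial.degree_mod_lt g hf0
      rwa [Polynomial.degree_eq_natDegree hf0, hdeg] at this
    have hQ : Q.natDegree < s := by
      rcases eq_or_ne Q 0 with hQ0 | hQ0
      · rw [hQ0, Polynomial.natDegree_zero]
        omega
      have hfQ : f * Q = g - r := eq_sub_of_add_eq hdm
      have hr : r.natDegree < 2 * s := by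
        rcases eq_or_ne r 0 with hr0 | hr0
        · rw [hr0, Polynomial.natDegree_zero]
          omega
        · exact (Polynomial.natDegree_lt_iff_degree_lt hr0).2 (hrdeg.trans_le
            (by exact_mod_cast (by omega : s ≤ 2 * s)))
      have h1 := Polynomial.natDegree_sub_le g r
      rw [← hfQ, Polynomial.natDegree_mul hf0 hQ0, hdeg] at h1
      omega
    have h1 : ∀ i, lam i * g.eval (t i) =
        lam i * (f.eval (t i) * Q.eval (t i)) + lam i * r.eval (t i) := by
      intro i
      rw [← hdm, Polynomial.eval_add, Polynomial.eval_mul]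
      ring
    have h2 : ∀ j, g.eval (τ j) = r.eval (τ j) := by
      intro j
      rw [← hdm, Polynomial.eval_add, Polynomial.eval_mul, hτ, zero_mul, zero_add]
    have h3 : r = Lagrange.interpolate Finset.univ τ fun j => r.eval (τ j) :=
      Lagrange.eq_interpolate hτinj (by simpa using hrdeg)
    have h4 : ∀ i, r.eval (t i) = ∑ j, r.eval (τ j) * (l j).eval (t i) := by
      intro i
      conv_lhs => rw [h3]
      rw [Lagrange.interpolate_apply, Polynomial.eval_finsetSum]
      exact Finset.sum_congr rfl fun j _ => by rw [Polynomial.eval_mul, Polynomial.eval_C]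
    simp only [h1, h2, h4, Finset.sum_add_distrib, horth Q hQ, zero_add, w, Finset.mul_sum,
      Finset.sum_mul]
    rw [Finset.sum_comm]
    exact Finset.sum_congr rfl fun j _ => Finset.sum_congr rfl fun i _ => by ring
  have hw : ∀ j, 0 ≤ w j := by
    intro j
    have hl : (l j).natDegree = s - 1 := by
      simpa using Lagrange.natDegree_basis hτinj (Finset.mem_univ j)
    -- The square of a Lagrange basis polynomial has degree `2s - 2`, so the rule is exact on it and
    -- exhibits `w j` as a sum of nonnegative terms.
    have := hlow (l j ^ 2) (by rw [Polynomial.natDegree_pow, hl]; omega)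
    rw [Finset.sum_eq_single j] at this
    · rw [Polynomial.eval_pow, Lagrange.eval_basis_self hτinj (Finset.mem_univ j), one_pow,
        mul_one] at this
      rw [← this]
      refine Finset.sum_nonneg fun i _ => mul_nonneg (hlam i).le ?_
      rw [Polynomial.eval_pow]
      exact sq_nonneg _
    · intro k _ hk
      rw [Polynomial.eval_pow, Lagrange.eval_basis_of_ne hk.symm (Finset.mem_univ k)]
      ring
    · simp
  have ha : f.leadingCoeff ≠ 0 := Polynomial.leadingCoeff_ne_zero.2 hf0
  refine ⟨w, τ, (∑ i, lam i * f.eval (t i) ^ 2) / f.leadingCoeff ^ 2, hw, ?_, fun g hg => ?_⟩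
  · exact div_nonneg (Finset.sum_nonneg fun i _ => mul_nonneg (hlam i).le (sq_nonneg _))
      (sq_nonneg _)
  -- Subtracting `κ f²` removes the top coefficient without changing the values at the roots of `f`.
  · set κ := g.coeff (2 * s) / f.leadingCoeff ^ 2 with hκ
    have hsqdeg : (f ^ 2).natDegree = 2 * s := by rw [Polynomial.natDegree_pow, hdeg]
    have hsqcoeff : (f ^ 2).coeff (2 * s) = f.leadingCoeff ^ 2 := by
      rw [← hsqdeg, Polynomial.coeff_natDegree, Polynomial.leadingCoeff_pow]
    have hdeg' : (g - Polynomial.C κ * f ^ 2).natDegree < 2 * s := by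
      have hle : (g - Polynomial.C κ * f ^ 2).natDegree ≤ 2 * s :=
        (Polynomial.natDegree_sub_le_of_le hg
          ((Polynomial.natDegree_C_mul_le _ _).trans hsqdeg.le)).trans (max_self _).le
      refine lt_of_le_of_ne hle fun h => ?_
      have h0 : (g - Polynomial.C κ * f ^ 2).coeff (2 * s) = 0 := by
        rw [Polynomial.coeff_sub, Polynomial.coeff_C_mul, hsqcoeff, hκ]
        field_simp
        ring
      rw [← h, Polynomial.coeff_natDegree, Polynomial.leadingCoeff_eq_zero] at h0
      rw [h0, Polynomial.natDegree_zero] at h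
      omega
    have := hlow _ hdeg'
    simp only [Polynomial.eval_sub, Polynomial.eval_mul, Polynomial.eval_C, Polynomial.eval_pow,
      hτ] at this
    have h5 : ∑ i, lam i * g.eval (t i) =
        ∑ i, lam i * (g.eval (t i) - κ * f.eval (t i) ^ 2) + κ * ∑ i, lam i * f.eval (t i) ^ 2 := by
      rw [Finset.mul_sum, ← Finset.sum_add_distrib]
      exact Finset.sum_congr rfl fun i _ => by ring
    rw [h5, this, hκ]
    congr 1
    · exact Finset.sum_congr rfl fun j _ => by ring
    · ring

/-! ### Shortening representations with more than `s` terms of one sign -/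

theorem linForm_fin_two (L : Fin 2 → ℝ) : linForm L = C (L 0) * X 0 + C (L 1) * X 1 := by
  simp [linForm]

/-- Gauss quadrature for binary forms: a sum of `s + 1` powers of pairwise independent linear forms
is a sum of `s` powers and a nonnegative multiple of the power of any further linear form. -/
theorem exists_sum_linForm_pow_eq {s : ℕ} (hs : 1 ≤ s) {P : Fin (s + 1) → Fin 2 → ℝ}
    (hP : ∀ i j, i ≠ j → det2 (P i) (P j) ≠ 0) {l : Fin 2 → ℝ} (hl : ∀ i, det2 l (P i) ≠ 0) :
    ∃ (Q : Fin s → Fin 2 → ℝ) (ν : ℝ), 0 ≤ ν ∧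
      ∑ i, linForm (P i) ^ (2 * s) =
        ∑ j, linForm (Q j) ^ (2 * s) + C ν * linForm l ^ (2 * s) := by
  have hD : l 0 ^ 2 + l 1 ^ 2 ≠ 0 := by
    intro h
    apply hl 0
    have h0 : l 0 = 0 := by nlinarith [sq_nonneg (l 0), sq_nonneg (l 1)]
    have h1 : l 1 = 0 := by nlinarith [sq_nonneg (l 0), sq_nonneg (l 1)]
    simp [det2, h0, h1]
  set D := l 0 ^ 2 + l 1 ^ 2 with hDdef
  -- In the basis `l`, `l'` the point `l` lies at infinity, and each `P i` is a nonzero multiple of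
  -- an affine point `t i • l + l'`.
  let l' : Fin 2 → ℝ := ![-l 1, l 0]
  let b : Fin (s + 1) → ℝ := fun i => det2 l (P i) / D
  let t : Fin (s + 1) → ℝ := fun i => (l 0 * P i 0 + l 1 * P i 1) / det2 l (P i)
  have hb : ∀ i, b i ≠ 0 := fun i => div_ne_zero (hl i) hD
  have hPt : ∀ i, P i = b i • (t i • l + l') := by
    intro i
    have hi := hl i
    ext k
    fin_cases k
    · simp only [b, t, l', Fin.zero_eta, Pi.smul_apply, Pi.add_apply, smul_eq_mul,
        Matrix.cons_val_zero]
      field_simp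
      simp only [det2]
      ring
    · simp only [b, t, l', Fin.mk_one, Pi.smul_apply, Pi.add_apply, smul_eq_mul,
        Matrix.cons_val_one, Matrix.cons_val_zero]
      field_simp
      simp only [det2]
      ring
  have ht : Function.Injective t := by
    intro i j hij
    by_contra hne
    apply hP i j hne
    rw [hPt i, hPt j, hij]
    simp only [det2, Pi.smul_apply, smul_eq_mul]
    ring
  obtain ⟨w, τ, ν, hw, hν, hquad⟩ := exists_gauss_quadrature hs
    (lam := fun i => b i ^ (2 * s)) (fun i => by have := hb i; rw [pow_mul]; positivity) ht
  choose d hd using fun j => exists_root_smul hs (hw j) (τ j • l + l')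
  refine ⟨fun j => d j • (τ j • l + l'), ν, hν, ?_⟩
  have hexp : ∀ x : ℝ, linForm (x • l + l') ^ (2 * s) = ∑ m ∈ Finset.range (2 * s + 1),
      C (x ^ m) * (linForm l ^ m * linForm l' ^ (2 * s - m) * ((2 * s).choose m : MvPolynomial (Fin 2) ℝ)) := by
    intro x
    rw [linForm_add, linForm_smul, add_pow]
    refine Finset.sum_congr rfl fun m _ => ?_
    rw [mul_pow, C_pow]
    ring
  -- The top-coefficient functional plays the role of evaluation at infinity, so the quadrature
  -- identity can be applied to each monomial.
  have htop : linForm l ^ (2 * s) = ∑ m ∈ Finset.range (2 * s + 1),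
      C ((Polynomial.X ^ m : Polynomial ℝ).coeff (2 * s)) *
        (linForm l ^ m * linForm l' ^ (2 * s - m) * ((2 * s).choose m : MvPolynomial (Fin 2) ℝ)) := by
    rw [Finset.sum_eq_single (2 * s)]
    · simp
    · intro m _ hm
      rw [Polynomial.coeff_X_pow, if_neg hm.symm, C_0, zero_mul]
    · simp
  simp only [hd]
  have hPpow : ∀ i, linForm (P i) ^ (2 * s) =
      C (b i ^ (2 * s)) * linForm (t i • l + l') ^ (2 * s) := by
    intro i
    conv_lhs => rw [hPt i]
    rw [linForm_smul, mul_pow, C_pow]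
  simp only [hPpow, hexp]
  rw [htop]
  simp only [Finset.mul_sum]
  rw [Finset.sum_comm, Finset.sum_comm (s := Finset.univ), ← Finset.sum_add_distrib]
  refine Finset.sum_congr rfl fun m hm => ?_
  have hm' : m ≤ 2 * s := by simpa [Nat.lt_succ_iff] using hm
  have := hquad (Polynomial.X ^ m) (by simpa using hm')
  simp only [Polynomial.eval_pow, Polynomial.eval_X] at this
  simp only [← mul_assoc, ← C_mul, ← Finset.sum_mul, ← map_sum, ← add_mul, ← C_add]
  rw [this]

theorem HasRep.add {s : ℕ} {p q : MvPolynomial (Fin 2) ℝ} {a b c d : ℕ} (hp : HasRep s p a b)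
    (hq : HasRep s q c d) : HasRep s (p + q) (a + c) (b + d) := by
  obtain ⟨P, N, rfl⟩ := hp
  obtain ⟨P', N', rfl⟩ := hq
  refine ⟨Fin.append P P', Fin.append N N', ?_⟩
  simp only [Fin.sum_univ_add, Fin.append_left, Fin.append_right]
  ring

theorem hasRep_sum {s a : ℕ} (P : Fin a → Fin 2 → ℝ) :
    HasRep s (∑ i, linForm (P i) ^ (2 * s)) a 0 := ⟨P, Fin.elim0, by simp⟩

theorem hasRep_C_mul_linForm_pow {s : ℕ} (hs : 1 ≤ s) {c : ℝ} (hc : 0 ≤ c) (L : Fin 2 → ℝ) :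
    HasRep s (C c * linForm L ^ (2 * s)) 1 0 := by
  obtain ⟨d, hd⟩ := exists_root_smul hs hc L
  exact ⟨fun _ => d • L, Fin.elim0, by simp [hd]⟩

/-- A spare positive form absorbs `ν l²ˢ`, saving one positive term. A negative form `l` acquires
the coefficient `ν - 1`: either it becomes a positive term and `b` drops, or it stays negative (or
vanishes) and `a` drops. -/
theorem MinimalRep.eq_of_lt_fst {s : ℕ} (hs : 1 ≤ s) {p : MvPolynomial (Fin 2) ℝ} {a b : ℕ}
    (h : MinimalRep s p (a, b)) (ha : s < a) : a = s + 1 ∧ b = 0 := by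
  obtain ⟨a', rfl⟩ : ∃ a', a = s + 1 + a' := ⟨a - (s + 1), by omega⟩
  obtain ⟨P, N, rfl⟩ := h.1
  simp only at P N h
  have hP : ∀ i j : Fin (s + 1), i ≠ j →
      det2 (P (Fin.castAdd a' i)) (P (Fin.castAdd a' j)) ≠ 0 := fun i j hij =>
    h.left_det2_ne_zero hs fun e => hij (Fin.castAdd_injective _ _ e)
  have hsplit := Fin.sum_univ_add fun i => linForm (P i) ^ (2 * s)
  constructor
  · rcases a' with _ | k
    · rfl
    exfalso
    obtain ⟨Q, ν, hν, hQ⟩ := exists_sum_linForm_pow_eq hs hP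
      (l := P (Fin.natAdd (s + 1) 0)) fun i => h.left_det2_ne_zero hs fun e => by
        have := congrArg Fin.val e
        simp at this
        omega
    refine h.not_fst (a' := s + 1 + k) (by omega) ?_
    have := (((hasRep_sum Q).add (hasRep_C_mul_linForm_pow hs (by linarith : 0 ≤ 1 + ν)
      (P (Fin.natAdd (s + 1) 0)))).add
      (hasRep_sum fun i : Fin k => P (Fin.natAdd (s + 1) i.succ))).add (hasRep_sum N).neg
    convert this using 1
    · rw [hsplit, hQ, Fin.sum_univ_succ, C_add, C_1]
      ring
    · omega
    · omega
  · rcases b with _ | b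
    · rfl
    exfalso
    obtain ⟨Q, ν, hν, hQ⟩ := exists_sum_linForm_pow_eq hs hP (l := N 0) fun i => by
      rw [det2_swap]
      exact neg_ne_zero.2 (h.det2_ne_zero hs _ _)
    have hbase := ((hasRep_sum (s := s) Q).add
      (hasRep_sum fun i : Fin a' => P (Fin.natAdd (s + 1) i))).add
      (hasRep_sum fun j : Fin b => N j.succ).neg
    rcases le_total 1 ν with h1 | h1
    · refine h.not_snd (b' := b) (by omega) ?_
      convert hbase.add (hasRep_C_mul_linForm_pow hs (sub_nonneg.2 h1) (N 0)) using 1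
      · rw [hsplit, hQ, Fin.sum_univ_succ, C_sub, C_1]
        ring
      · omega
      · omega
    · refine h.not_fst (a' := s + a') (by omega) ?_
      convert hbase.add (hasRep_C_mul_linForm_pow hs (sub_nonneg.2 h1) (N 0)).neg using 1
      · rw [hsplit, hQ, Fin.sum_univ_succ, C_sub, C_1]
        ring
      · omega
      · omega

theorem MinimalRep.mem_possibleSignatures {s : ℕ} (hs : 1 ≤ s) {p : MvPolynomial (Fin 2) ℝ}
    {ab : ℕ × ℕ} (h : MinimalRep s p ab) : ab ∈ possibleSignatures s := by
  obtain ⟨a, b⟩ := ab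
  rcases lt_or_ge s a with ha | ha
  · obtain ⟨rfl, rfl⟩ := h.eq_of_lt_fst hs ha
    simp [possibleSignatures]
  rcases lt_or_ge s b with hb | hb
  · obtain ⟨rfl, rfl⟩ := h.neg.eq_of_lt_fst hs hb
    simp [possibleSignatures]
  · simp [possibleSignatures, ha, hb]

/-! ### Powers of linear forms span -/

theorem pairing_X_pow {n k : ℕ} (hk : k ≤ n) (p : MvPolynomial (Fin 2) ℝ) :
    pairing n (Polynomial.X ^ k) p =
      coeff (Finsupp.single 0 k + Finsupp.single 1 (n - k)) p / n.choose k := by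
  rw [pairing, LinearMap.sum_apply, Finset.sum_eq_single k]
  · rw [LinearMap.smul_apply, lcoeff_apply, Polynomial.coeff_X_pow_self, smul_eq_mul]
    ring
  · intro j _ hj
    rw [LinearMap.smul_apply, Polynomial.coeff_X_pow, if_neg hj, zero_div, zero_smul]
  · intro h
    simp at h
    omega

theorem eq_of_pairing_X_pow_eq {n : ℕ} {p q : MvPolynomial (Fin 2) ℝ} (hp : p.IsHomogeneous n)
    (hq : q.IsHomogeneous n)
    (h : ∀ k ≤ n, pairing n (Polynomial.X ^ k) p = pairing n (Polynomial.X ^ k) q) : p = q := by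
  ext m
  have hdeg : m.degree = m 0 + m 1 := by simp [Finsupp.degree_eq_sum]
  by_cases hm : m.degree = n
  · have hle : m 0 ≤ n := by omega
    have hme : m = Finsupp.single 0 (m 0) + Finsupp.single 1 (n - m 0) := by
      ext i
      fin_cases i <;> simp
      omega
    have := h (m 0) hle
    rw [pairing_X_pow hle, pairing_X_pow hle, ← hme] at this
    have hc : (n.choose (m 0) : ℝ) ≠ 0 := by exact_mod_cast (Nat.choose_pos hle).ne'
    exact (div_left_inj' hc).1 this
  · rw [hp.coeff_eq_zero hm, hq.coeff_eq_zero hm]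

theorem pairing_sum_left {ι : Type*} (u : Finset ι) (n : ℕ) (a : ι → ℝ) (g : ι → Polynomial ℝ)
    (p : MvPolynomial (Fin 2) ℝ) :
    pairing n (∑ i ∈ u, Polynomial.C (a i) * g i) p = ∑ i ∈ u, a i * pairing n (g i) p := by
  simp only [pairing, LinearMap.sum_apply, LinearMap.smul_apply, smul_eq_mul, Finset.mul_sum,
    Polynomial.finsetSum_coeff, Polynomial.coeff_C_mul, Finset.sum_div, Finset.sum_mul]
  rw [Finset.sum_comm]
  exact Finset.sum_congr rfl fun i _ => Finset.sum_congr rfl fun k _ => by ring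

/-- Powers of linear forms span the binary forms. -/
theorem exists_eq_sum_C_mul_linForm_pow {n : ℕ} {p : MvPolynomial (Fin 2) ℝ}
    (hp : p.IsHomogeneous n) : ∃ (c : Fin (n + 1) → ℝ) (L : Fin (n + 1) → Fin 2 → ℝ),
      p = ∑ i, C (c i) * linForm (L i) ^ n := by
  let t : Fin (n + 1) → ℝ := fun i => (i : ℝ)
  have ht : Set.InjOn t (Finset.univ : Finset (Fin (n + 1))) := fun i _ j _ hij =>
    Fin.ext (Nat.cast_injective hij)
  -- Interpolating `X ^ k` at the nodes turns its pairing with `p` into `∑ t i ^ k * c i`, which is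
  -- its pairing with the proposed sum.
  let c : Fin (n + 1) → ℝ := fun i => pairing n (Lagrange.basis Finset.univ t i) p
  refine ⟨c, fun i => ![t i, 1], eq_of_pairing_X_pow_eq hp ?_ fun k hk => ?_⟩
  · exact IsHomogeneous.sum _ _ _ fun i _ => by
      simpa using (isHomogeneous_C (Fin 2) (c i)).mul ((isHomogeneous_linForm ![t i, 1]).pow n)
  · have hX := Lagrange.eq_interpolate (f := (Polynomial.X ^ k : Polynomial ℝ)) ht
      (by
        rw [Polynomial.degree_X_pow, Finset.card_univ, Fintype.card_fin]
        exact_mod_cast Nat.lt_succ_of_le hk)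
    have hdeg : (Polynomial.X ^ k : Polynomial ℝ).natDegree ≤ n := by simpa using hk
    rw [Lagrange.interpolate_apply] at hX
    conv_lhs => rw [hX, pairing_sum_left]
    simp only [← smul_eq_C_mul, map_sum, map_smul, pairing_linForm_pow, smul_eq_mul,
      hev_affine hdeg]
    exact Finset.sum_congr rfl fun i _ => mul_comm _ _

theorem exists_hasRep {s : ℕ} (hs : 1 ≤ s) {p : MvPolynomial (Fin 2) ℝ}
    (hp : p.IsHomogeneous (2 * s)) : ∃ a b, HasRep s p a b := by
  obtain ⟨c, L, rfl⟩ := exists_eq_sum_C_mul_linForm_pow hp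
  have h := HasRep.of_sum_weights hs Finset.univ Finset.univ L L (fun i => max (c i) 0)
    (fun i => max (-c i) 0) (fun _ _ => le_max_right _ _) (fun _ _ => le_max_right _ _)
  rw [← Finset.sum_sub_distrib] at h
  simp only [← sub_mul, ← C_sub, max_zero_sub_max_neg_zero_eq_self] at h
  exact ⟨_, _, h⟩

/-! ### Derivatives of products of real linear forms -/

/-- The directional derivative of a binary form. -/
noncomputable def dirDeriv (w : Fin 2 → ℝ) :
    Derivation ℝ (MvPolynomial (Fin 2) ℝ) (MvPolynomial (Fin 2) ℝ) :=
  w 0 • pderiv 0 + w 1 • pderiv 1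

theorem dirDeriv_linForm (w L : Fin 2 → ℝ) : dirDeriv w (linForm L) = C (w ⬝ᵥ L) := by
  simp [dirDeriv, linForm_fin_two, dotProduct, smul_eq_C_mul]

theorem dirDeriv_linForm_pow (w L : Fin 2 → ℝ) (n : ℕ) :
    dirDeriv w (linForm L ^ (n + 1)) = C ((n + 1) * (w ⬝ᵥ L)) * linForm L ^ n := by
  rw [Derivation.leibniz_pow, dirDeriv_linForm, C_mul]
  simp [smul_eq_mul]
  ring

theorem derivation_aeval {A : Type*} [CommRing A] [Algebra ℝ A] (D : Derivation ℝ A A)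
    (g : Fin 2 → A) (q : MvPolynomial (Fin 2) ℝ) :
    D (aeval g q) = ∑ i, aeval g (pderiv i q) * D (g i) := by
  induction q using MvPolynomial.induction_on with
  | C r => simp [algHom_C]
  | add p q hp hq => simp only [map_add, hp, hq, ← Finset.sum_add_distrib, add_mul]
  | mul_X p k hp =>
    rw [map_mul, aeval_X, Derivation.leibniz, hp]
    simp only [Derivation.leibniz, pderiv_X, smul_eq_mul, map_add, map_mul, aeval_X,
      Fin.sum_univ_two]
    fin_cases k <;> simp <;> ring

theorem pderiv_homogenize (n : ℕ) {f : Polynomial ℝ} (hf : f.natDegree ≤ n + 1) :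
    pderiv 0 (f.homogenize (n + 1)) = (Polynomial.derivative f).homogenize n := by
  symm
  apply Polynomial.homogenize_eq_of_isHomogeneous
  · exact (Polynomial.isHomogeneous_homogenize f).pderiv
  · have := derivation_aeval (A := Polynomial ℝ) Polynomial.derivative' ![Polynomial.X, 1]
      (f.homogenize (n + 1))
    rw [Polynomial.aeval_homogenize_X_one f hf] at this
    simpa [Fin.sum_univ_two] using this.symm

theorem homogenize_linPoly (m : Fin 2 → ℝ) : (linPoly m).homogenize 1 = linForm m := by
  simp [linPoly, linForm_fin_two]

theorem natDegree_multiset_prod_linPoly_le (S : Multiset (Fin 2 → ℝ)) :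
    (S.map linPoly).prod.natDegree ≤ S.card := by
  induction S using Multiset.induction_on with
  | empty => simp
  | cons m S ih =>
    rw [Multiset.map_cons, Multiset.prod_cons, Multiset.card_cons, add_comm]
    exact Polynomial.natDegree_mul_le_of_le (natDegree_linPoly_le m) ih

theorem homogenize_multiset_prod_linPoly (S : Multiset (Fin 2 → ℝ)) :
    (S.map linPoly).prod.homogenize S.card = (S.map linForm).prod := by
  induction S using Multiset.induction_on with
  | empty => simp
  | cons m S ih =>
    rw [Multiset.map_cons, Multiset.prod_cons, Multiset.card_cons, Multiset.map_cons,
      Multiset.prod_cons, add_comm, Polynomial.homogenize_mul _ _ (natDegree_linPoly_le m)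
        (natDegree_multiset_prod_linPoly_le S), ih, homogenize_linPoly]

/-- Rolle: the derivative of a real polynomial with only real roots has only real roots. -/
theorem splits_derivative {f : Polynomial ℝ} (hf : f.Splits) :
    (Polynomial.derivative f).Splits := by
  rw [Polynomial.splits_iff_card_roots] at hf ⊢
  have h1 := Polynomial.card_roots_le_derivative f
  have h2 := Polynomial.card_roots' (Polynomial.derivative f)
  have h3 := Polynomial.natDegree_derivative_le f
  omega

/-- Products of `n` real linear forms. -/
def IsHyperbolic (n : ℕ) (p : MvPolynomial (Fin 2) ℝ) : Prop :=
  ∃ S : Multiset (Fin 2 → ℝ), S.card = n ∧ p = (S.map linForm).prod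

theorem IsHyperbolic.C_mul {n : ℕ} (hn : n ≠ 0) {p : MvPolynomial (Fin 2) ℝ}
    (hp : IsHyperbolic n p) (c : ℝ) : IsHyperbolic n (C c * p) := by
  obtain ⟨S, hS, rfl⟩ := hp
  obtain ⟨v, hv⟩ := Multiset.card_pos_iff_exists_mem.1 (by omega : 0 < S.card)
  obtain ⟨S, rfl⟩ := Multiset.exists_cons_of_mem hv
  refine ⟨(c • v) ::ₘ S, by simpa using hS, ?_⟩
  rw [Multiset.map_cons, Multiset.map_cons, Multiset.prod_cons, Multiset.prod_cons, linForm_smul]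
  ring

theorem isHyperbolic_homogenize {n : ℕ} (hn : n ≠ 0) {f : Polynomial ℝ} (hf : f.Splits)
    (hfn : f.natDegree ≤ n) : IsHyperbolic n (f.homogenize n) := by
  rw [hf.eq_prod_roots, Polynomial.homogenize_C_mul]
  apply IsHyperbolic.C_mul hn
  have hcard := hf.natDegree_eq_card_roots
  have hlin : f.roots.map (fun a => Polynomial.X - Polynomial.C a) =
      (f.roots.map fun a => ![1, -a]).map linPoly := by
    rw [Multiset.map_map]
    refine Multiset.map_congr rfl fun a _ => ?_
    simp [linPoly, sub_eq_add_neg]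
  -- The gap between `n` and the degree of `f` is filled by roots at infinity, the factors `X 1`.
  refine ⟨(f.roots.map fun a => ![1, -a]) + Multiset.replicate (n - f.natDegree) ![0, 1], ?_, ?_⟩
  · simp
    omega
  · have h := Polynomial.homogenize_mul ((f.roots.map fun a => ![1, -a]).map linPoly).prod 1
      (natDegree_multiset_prod_linPoly_le _) (n := n - f.natDegree) (by simp)
    rw [homogenize_multiset_prod_linPoly, mul_one, Multiset.card_map, ← hcard,
      Nat.add_sub_cancel' hfn] at h
    rw [hlin, h, Multiset.map_add, Multiset.prod_add]
    simp [linForm_fin_two]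

theorem IsHyperbolic.dirDeriv {n : ℕ} (hn : n ≠ 0) {p : MvPolynomial (Fin 2) ℝ}
    (hp : IsHyperbolic (n + 1) p) (w : Fin 2 → ℝ) : IsHyperbolic n (dirDeriv w p) := by
  obtain ⟨S, hS, rfl⟩ := hp
  by_cases hw : w ⬝ᵥ w = 0
  · have hw0 : w = 0 := dotProduct_self_eq_zero.1 hw
    refine ⟨Multiset.replicate n 0, by simp, ?_⟩
    simp [_root_.dirDeriv, hw0, linForm_zero, hn]
  have hw' : w 0 * w 0 + w 1 * w 1 ≠ 0 := by simpa [dotProduct] using hw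
  set D := w 0 * w 0 + w 1 * w 1 with hD
  let z : Fin 2 → ℝ := ![-w 1, w 0]
  -- A linear change of variables adapted to `w`: it turns `dirDeriv w` into `pderiv 0`, reducing
  -- the claim to Rolle in one variable.
  let φ : MvPolynomial (Fin 2) ℝ →ₐ[ℝ] MvPolynomial (Fin 2) ℝ :=
    aeval ![linForm (D⁻¹ • w), linForm (D⁻¹ • z)]
  have hφ : ∀ m : Fin 2 → ℝ, φ (linForm m) = linForm (m 0 • D⁻¹ • w + m 1 • D⁻¹ • z) := by
    intro m
    rw [linForm_add, linForm_smul (m 0), linForm_smul (m 1), linForm_fin_two m]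
    simp [φ, algHom_C, algebraMap_eq]
  have hφS : ∀ T : Multiset (Fin 2 → ℝ), φ (T.map linForm).prod =
      ((T.map fun m => m 0 • D⁻¹ • w + m 1 • D⁻¹ • z).map linForm).prod := by
    intro T
    rw [map_multiset_prod, Multiset.map_map, Multiset.map_map]
    simp only [Function.comp_def, hφ]
  have hder : ∀ q, _root_.dirDeriv w (φ q) = φ (pderiv 0 q) := by
    intro q
    have h0 : w ⬝ᵥ (D⁻¹ • w) = 1 := by
      simp only [dotProduct, Fin.sum_univ_two, Pi.smul_apply, smul_eq_mul]
      field_simp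
      rw [hD]; ring
    have h1 : w ⬝ᵥ (D⁻¹ • z) = 0 := by
      simp [dotProduct, Fin.sum_univ_two, z]
      ring
    have := derivation_aeval (_root_.dirDeriv w) ![linForm (D⁻¹ • w), linForm (D⁻¹ • z)] q
    simpa only [Fin.sum_univ_two, Matrix.cons_val_zero, Matrix.cons_val_one, dirDeriv_linForm, h0,
      h1, C_1, C_0, mul_one, mul_zero, add_zero] using this
  let T : Multiset (Fin 2 → ℝ) := S.map fun M => ![w ⬝ᵥ M, z ⬝ᵥ M]
  have hT : T.card = n + 1 := by simp [T, hS]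
  have hST : (S.map linForm).prod = φ (T.map linForm).prod := by
    rw [hφS, Multiset.map_map]
    congr 1
    conv_lhs => rw [← Multiset.map_id S]
    rw [Multiset.map_map]
    simp only [T, Multiset.map_map]
    refine Multiset.map_congr rfl fun M _ => ?_
    simp only [Function.comp_apply, id]
    congr 1
    ext i
    fin_cases i
    · simp [z, dotProduct, Fin.sum_univ_two]
      field_simp
      rw [hD]; ring
    · simp [z, dotProduct, Fin.sum_univ_two]
      field_simp
      rw [hD]; ring
  have hdeg := natDegree_multiset_prod_linPoly_le T
  have hsplit : (T.map linPoly).prod.Splits := Polynomial.Splits.multisetProd fun f hf => by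
    obtain ⟨m, _, rfl⟩ := Multiset.mem_map.1 hf
    exact Polynomial.Splits.of_natDegree_le_one (natDegree_linPoly_le m)
  rw [hT] at hdeg
  obtain ⟨R, hR, hR'⟩ := isHyperbolic_homogenize hn (splits_derivative hsplit)
    (by have := Polynomial.natDegree_derivative_le (T.map linPoly).prod; omega)
  rw [hST, hder, ← homogenize_multiset_prod_linPoly, hT, pderiv_homogenize n hdeg, hR', hφS]
  exact ⟨_, by simpa using hR, rfl⟩

/-- Iterated directional derivative. -/
noncomputable def iterDeriv (ws : List (Fin 2 → ℝ)) :
    MvPolynomial (Fin 2) ℝ →ₗ[ℝ] MvPolynomial (Fin 2) ℝ :=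
  ws.foldr (fun w T => (dirDeriv w : MvPolynomial (Fin 2) ℝ →ₗ[ℝ] MvPolynomial (Fin 2) ℝ).comp T)
    LinearMap.id

theorem iterDeriv_cons (w : Fin 2 → ℝ) (ws : List (Fin 2 → ℝ)) (p : MvPolynomial (Fin 2) ℝ) :
    iterDeriv (w :: ws) p = dirDeriv w (iterDeriv ws p) := rfl

theorem IsHyperbolic.iterDeriv {n : ℕ} (hn : n ≠ 0) (ws : List (Fin 2 → ℝ)) :
    ∀ {p : MvPolynomial (Fin 2) ℝ}, IsHyperbolic (n + ws.length) p →
      IsHyperbolic n (iterDeriv ws p) := by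
  induction ws generalizing n with
  | nil => exact fun h => h
  | cons w ws ih =>
    intro p hp
    rw [iterDeriv_cons]
    refine IsHyperbolic.dirDeriv hn (ih (Nat.succ_ne_zero n) ?_) w
    rwa [List.length_cons, ← add_assoc, add_right_comm] at hp

/-- The constant `K` does not depend on `L`, so it factors out of a whole sum of powers. -/
theorem exists_iterDeriv_linForm_pow (m : ℕ) (ws : List (Fin 2 → ℝ)) :
    ∃ K : ℝ, 0 < K ∧ ∀ L : Fin 2 → ℝ, iterDeriv ws (linForm L ^ (m + ws.length)) =
      C (K * (ws.map fun w => w ⬝ᵥ L).prod) * linForm L ^ m := by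
  induction ws generalizing m with
  | nil => exact ⟨1, one_pos, fun L => by simp [iterDeriv]⟩
  | cons w ws ih =>
    obtain ⟨K, hK, h⟩ := ih (m + 1)
    refine ⟨K * (m + 1), by positivity, fun L => ?_⟩
    rw [iterDeriv_cons, List.length_cons, ← add_assoc, add_right_comm, h, ← smul_eq_C_mul,
      Derivation.map_smul, dirDeriv_linForm_pow, smul_eq_C_mul, ← mul_assoc, ← C_mul,
      List.map_cons, List.prod_cons]
    congr 2
    ring

theorem eval_linForm (x L : Fin 2 → ℝ) : eval x (linForm L) = x ⬝ᵥ L := by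
  simp [linForm, dotProduct, mul_comm]

theorem IsHyperbolic.exists_zero {n : ℕ} (hn : n ≠ 0) {p : MvPolynomial (Fin 2) ℝ}
    (hp : IsHyperbolic n p) : ∃ x : Fin 2 → ℝ, x ≠ 0 ∧ eval x p = 0 := by
  obtain ⟨S, hS, rfl⟩ := hp
  obtain ⟨v, hv⟩ := Multiset.card_pos_iff_exists_mem.1 (by omega : 0 < S.card)
  obtain ⟨x, hx, hxv⟩ := exists_ne_zero_dot_eq_zero v
  refine ⟨x, hx, ?_⟩
  rw [map_multiset_prod, Multiset.map_map]
  refine Multiset.prod_eq_zero (Multiset.mem_map.2 ⟨v, hv, ?_⟩)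
  simpa [eval_linForm, dotProduct] using hxv

theorem IsHyperbolic.exists_quadratic_zero {s a b : ℕ} {P : Fin a → Fin 2 → ℝ}
    {N : Fin b → Fin 2 → ℝ}
    (hp : IsHyperbolic (2 * s) (∑ i, linForm (P i) ^ (2 * s) - ∑ j, linForm (N j) ^ (2 * s)))
    (ws : List (Fin 2 → ℝ)) (hws : 2 + ws.length = 2 * s) :
    ∃ x : Fin 2 → ℝ, x ≠ 0 ∧
      ∑ i, (ws.map fun w => w ⬝ᵥ P i).prod * (x ⬝ᵥ P i) ^ 2 =
        ∑ j, (ws.map fun w => w ⬝ᵥ N j).prod * (x ⬝ᵥ N j) ^ 2 := by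
  obtain ⟨K, hK, h⟩ := exists_iterDeriv_linForm_pow 2 ws
  rw [← hws] at hp
  obtain ⟨x, hx, h0⟩ := (hp.iterDeriv two_ne_zero ws).exists_zero two_ne_zero
  refine ⟨x, hx, ?_⟩
  simp only [map_sub, map_sum, h, map_mul, eval_C, map_pow, eval_linForm, mul_assoc,
    ← Finset.mul_sum, ← mul_sub] at h0
  exact sub_eq_zero.1 ((mul_eq_zero.1 h0).resolve_left hK.ne')

theorem exists_dot_eq {u v : Fin 2 → ℝ} (h : det2 u v ≠ 0) (x y : ℝ) :
    ∃ z : Fin 2 → ℝ, z ⬝ᵥ u = x ∧ z ⬝ᵥ v = y := by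
  refine ⟨![(x * v 1 - y * u 1) / det2 u v, (y * u 0 - x * v 0) / det2 u v], ?_, ?_⟩ <;>
    simp only [dotProduct, Fin.sum_univ_two, Matrix.cons_val_zero, Matrix.cons_val_one] <;>
    field_simp <;> simp only [det2] <;> ring

theorem eq_zero_of_dot_eq_zero {u v x : Fin 2 → ℝ} (h : det2 u v ≠ 0) (hu : x ⬝ᵥ u = 0)
    (hv : x ⬝ᵥ v = 0) : x = 0 := by
  simp only [dotProduct, Fin.sum_univ_two] at hu hv
  ext i
  fin_cases i
  · apply (mul_eq_zero.1 (_ : x 0 * det2 u v = 0)).resolve_right h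
    simp only [det2]; linear_combination v 1 * hu - u 1 * hv
  · apply (mul_eq_zero.1 (_ : x 1 * det2 u v = 0)).resolve_right h
    simp only [det2]; linear_combination u 0 * hv - v 0 * hu

/-! ### Excluding short representations -/

/-- Every iterated derivative down to degree two of `∑ Pᵢ²ˢ - ∑ Nⱼ²ˢ` has a real zero. -/
def QuadraticZeros (s : ℕ) {a b : ℕ} (P : Fin a → Fin 2 → ℝ) (N : Fin b → Fin 2 → ℝ) : Prop :=
  ∀ ws : List (Fin 2 → ℝ), 2 + ws.length = 2 * s → ∃ x : Fin 2 → ℝ, x ≠ 0 ∧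
      ∑ i, (ws.map fun w => w ⬝ᵥ P i).prod * (x ⬝ᵥ P i) ^ 2 =
        ∑ j, (ws.map fun w => w ⬝ᵥ N j).prod * (x ⬝ᵥ N j) ^ 2

theorem QuadraticZeros.swap {s a b : ℕ} {P : Fin a → Fin 2 → ℝ} {N : Fin b → Fin 2 → ℝ}
    (h : QuadraticZeros s P N) : QuadraticZeros s N P := fun ws hws => by
  obtain ⟨x, hx, h⟩ := h ws hws
  exact ⟨x, hx, h.symm⟩

/-- Differentiating twice orthogonally to each `P i` kills the positive terms and weights each
negative term by a square. If two negative terms existed, the resulting quadratic would be definite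
and have no nontrivial zero. -/
theorem QuadraticZeros.card_le_one {s a b : ℕ} {P : Fin a → Fin 2 → ℝ} {N : Fin b → Fin 2 → ℝ}
    (h : QuadraticZeros s P N) (hPN : ∀ i j, det2 (P i) (N j) ≠ 0)
    (hN : ∀ i j, i ≠ j → det2 (N i) (N j) ≠ 0) (ha : a < s) : b ≤ 1 := by
  by_contra! hb
  let j₀ : Fin b := ⟨0, by omega⟩
  let j₁ : Fin b := ⟨1, hb⟩
  have hdet : det2 (N j₀) (N j₁) ≠ 0 := hN _ _ fun e => by simpa [j₀, j₁] using congrArg Fin.val e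
  obtain ⟨z, hz0, hz1⟩ := exists_dot_eq hdet 1 1
  -- The padding by `z` brings the length to `s - 1`; doubling the list makes all weights squares,
  -- and `z` pairs to `1` with both chosen negative forms.
  let base : List (Fin 2 → ℝ) :=
    (List.ofFn fun i => ![-P i 1, P i 0]) ++ List.replicate (s - 1 - a) z
  obtain ⟨x, hx, hsum⟩ := h (base ++ base) (by simp [base]; omega)
  simp only [List.map_append, List.prod_append, ← sq] at hsum
  have hperp : ∀ i L, ![-P i 1, P i 0] ⬝ᵥ L = det2 (P i) L := by
    intro i L
    simp [dotProduct, Fin.sum_univ_two, det2]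
    ring
  have hbase : ∀ L, (base.map fun w => w ⬝ᵥ L).prod =
      (∏ i, det2 (P i) L) * (z ⬝ᵥ L) ^ (s - 1 - a) := by
    intro L
    simp only [base, List.map_append, List.prod_append, List.map_ofFn, List.prod_ofFn,
      Function.comp_def, hperp, List.map_replicate, List.prod_replicate]
  have hPz : ∀ i, (base.map fun w => w ⬝ᵥ P i).prod = 0 := by
    intro i
    rw [hbase, Finset.prod_eq_zero (Finset.mem_univ i) (by simp [det2]; ring), zero_mul]
  have hNz : ∀ j, z ⬝ᵥ N j = 1 → (base.map fun w => w ⬝ᵥ N j).prod ≠ 0 := by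
    intro j hj
    rw [hbase, hj, one_pow, mul_one]
    exact Finset.prod_ne_zero_iff.2 fun i _ => hPN i j
  simp only [hPz, ne_eq, OfNat.ofNat_ne_zero, not_false_eq_true, zero_pow, zero_mul,
    Finset.sum_const_zero] at hsum
  have h0 := (Finset.sum_eq_zero_iff_of_nonneg fun j _ => by positivity).1 hsum.symm
  have hzero : ∀ j, z ⬝ᵥ N j = 1 → x ⬝ᵥ N j = 0 := fun j hj =>
    pow_eq_zero_iff two_ne_zero |>.1
      ((mul_eq_zero.1 (h0 j (Finset.mem_univ j))).resolve_left (pow_ne_zero 2 (hNz j hj)))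
  exact hx (eq_zero_of_dot_eq_zero hdet (hzero _ hz0) (hzero _ hz1))

theorem QuadraticZeros.not_one_one {s : ℕ} (hs : 2 ≤ s) {P N : Fin 1 → Fin 2 → ℝ}
    (h : QuadraticZeros s P N) : det2 (P 0) (N 0) = 0 := by
  by_contra hdet
  -- A single derivative along `w₁` flips the sign of the negative term, so the quadratic becomes a
  -- sum of two independent squares; this needs `2s - 2 ≥ 1`.
  obtain ⟨w₁, h1, h1'⟩ := exists_dot_eq hdet 1 (-1)
  obtain ⟨w₂, h2, h2'⟩ := exists_dot_eq hdet 1 1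
  obtain ⟨x, hx, hsum⟩ := h (w₁ :: List.replicate (2 * s - 3) w₂) (by simp; omega)
  simp only [Finset.univ_unique, Finset.sum_singleton, Fin.default_eq_zero, List.map_cons,
    List.prod_cons, List.map_replicate, List.prod_replicate, h1, h1', h2, h2', one_pow, mul_one,
    one_mul] at hsum
  have hP2 := sq_nonneg (x ⬝ᵥ P 0)
  have hN2 := sq_nonneg (x ⬝ᵥ N 0)
  have hP : x ⬝ᵥ P 0 = 0 := pow_eq_zero_iff two_ne_zero |>.1 (by linarith)
  have hN : x ⬝ᵥ N 0 = 0 := pow_eq_zero_iff two_ne_zero |>.1 (by linarith)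
  exact hx (eq_zero_of_dot_eq_zero hdet hP hN)

theorem IsHyperbolic.le_fst {s : ℕ} (hs : 1 ≤ s) {p : MvPolynomial (Fin 2) ℝ}
    (hp : IsHyperbolic (2 * s) p)
    (hne : ∀ l : Fin 2 → ℝ, p ≠ linForm l ^ (2 * s) ∧ p ≠ -(linForm l ^ (2 * s))) {a b : ℕ}
    (h : MinimalRep s p (a, b)) : s ≤ a := by
  by_contra! ha
  obtain ⟨P, N, rfl⟩ := h.1
  simp only at P N h hne
  have hq : QuadraticZeros s P N := fun ws hws => hp.exists_quadratic_zero ws hws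
  have hb := hq.card_le_one (h.det2_ne_zero hs) (fun _ _ => h.right_det2_ne_zero hs) ha
  have ha' : b < s → a ≤ 1 := hq.swap.card_le_one
    (fun j i => by rw [det2_swap]; exact neg_ne_zero.2 (h.det2_ne_zero hs i j))
    fun _ _ => h.left_det2_ne_zero hs
  -- If `b < s`, the argument applies with the signs exchanged; otherwise `s ≤ b ≤ 1` and `a < s`
  -- leave only `a = 0`.
  have ha1 : a ≤ 1 := by
    rcases lt_or_ge b s with hbs | hbs
    · exact ha' hbs
    · omega
  -- The pairs `(0, 0)`, `(0, 1)`, `(1, 0)` are the excluded forms `0` and `±l²ˢ`; for `(1, 1)`, `a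
  -- < s` gives `s ≥ 2`.
  interval_cases a <;> interval_cases b
  · exact (hne 0).1 (by simp [linForm_zero, Nat.one_le_iff_ne_zero.1 hs])
  · exact (hne (N 0)).2 (by simp)
  · exact (hne (P 0)).1 (by simp)
  · exact h.det2_ne_zero hs 0 0 (hq.not_one_one ha)

theorem IsHyperbolic.signatures_eq {s : ℕ} (hs : 1 ≤ s) {p : MvPolynomial (Fin 2) ℝ}
    (hp : IsHyperbolic (2 * s) p) (hp' : p.IsHomogeneous (2 * s))
    (hne : ∀ l : Fin 2 → ℝ, p ≠ linForm l ^ (2 * s) ∧ p ≠ -(linForm l ^ (2 * s))) :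
    signatures s p = {(s, s)} := by
  have key : ∀ ab, MinimalRep s p ab → ab = (s, s) := by
    rintro ⟨a, b⟩ h
    have hneg : IsHyperbolic (2 * s) (-p) := by simpa using hp.C_mul (by omega) (-1)
    have ha := hp.le_fst hs hne h
    have hb := hneg.le_fst hs (fun l => ⟨fun e => (hne l).2 (by rw [← e, neg_neg]),
      fun e => (hne l).1 (neg_injective e)⟩) h.neg
    have := h.mem_possibleSignatures hs
    simp only [possibleSignatures, Set.mem_union, Set.mem_insert_iff, Set.mem_singleton_iff,
      Prod.mk.injEq, Set.mem_prod, Set.mem_Icc] at this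
    ext <;> simp only <;> omega
  obtain ⟨a, b, hab⟩ := exists_hasRep hs hp'
  obtain ⟨m, -, hm⟩ := hab.exists_minimal
  ext ab
  rw [mem_signatures_iff hs, Set.mem_singleton_iff]
  exact ⟨key ab, fun e => by rw [e, ← key m hm]; exact hm⟩

/-! ### Conclusion -/

theorem signatures_neg {s : ℕ} (hs : 1 ≤ s) (p : MvPolynomial (Fin 2) ℝ) :
    signatures s (-p) = Prod.swap '' signatures s p := by
  ext ⟨a, b⟩
  rw [Set.image_swap_eq_preimage_swap, Set.mem_preimage, mem_signatures_iff hs,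
    mem_signatures_iff hs]
  exact ⟨fun h => by simpa using h.neg, fun h => MinimalRep.neg h⟩

theorem theorem3p1 (s : ℕ) (hs : 1 ≤ s) :
    (∀ p ∈ F 2 (2 * s), signatures s p ⊆ possibleSignatures s) ∧
    (∀ p ∈ F 2 (2 * s),
      (∃ M : Fin (2 * s) → Fin 2 → ℝ, p = ∏ i, linForm (M i)) →
      (∀ l : Fin 2 → ℝ, p ≠ linForm l ^ (2 * s) ∧ p ≠ -(linForm l ^ (2 * s))) →
      signatures s p = {(s, s)}) ∧
    (∀ uv ∈ possibleSignatures s, ∃ p ∈ F 2 (2 * s), signatures s p = {uv}) := by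
  refine ⟨fun p _ ab hab => ((mem_signatures_iff hs).1 hab).mem_possibleSignatures hs, ?_, ?_⟩
  · rintro p hp ⟨M, hM⟩ hne
    refine IsHyperbolic.signatures_eq hs ⟨Finset.univ.val.map M, by simp, ?_⟩ hp hne
    rw [hM, Multiset.map_map]
    rfl
  · rintro ⟨u, v⟩ huv
    have hmem : ∑ k : Fin (s + 1), linForm ![(k : ℝ), 1] ^ (2 * s) ∈ F 2 (2 * s) :=
      Submodule.sum_mem _ fun k _ => by simpa using (isHomogeneous_linForm ![(k : ℝ), 1]).pow (2 * s)
    simp only [possibleSignatures, Set.mem_union, Set.mem_insert_iff, Set.mem_singleton_iff,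
      Set.mem_prod, Set.mem_Icc] at huv
    rcases huv with (h | h) | ⟨⟨-, hu⟩, -, hv⟩
    · rw [h]
      exact ⟨_, hmem, signatures_succ_zero hs⟩
    · rw [h]
      refine ⟨_, Submodule.neg_mem _ hmem, ?_⟩
      rw [signatures_neg hs, signatures_succ_zero hs]
      simp
    · exact exists_signatures_eq_of_le hs hu hv
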